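/- **Setting.** Let $C,D\ge 0$ be integers, $R\subseteq\mathbb R^D$ measurable, and for $j=1,\dots,C$ let $\phi_{j,n}:\mathbb R^D\to\mathbb C$ ($n\in\mathbb B_j$) be mode functions that are orthonormal in $L^2(R)$. Let $\mathbb M_j\subseteq\mathbb B_j$ be finite sets of modes, $\mathbb F_{\mathbb M_j}=\operatorname{span}\{\phi_{j,n}:n\in\mathbb M_j\}$, and let $a_{j,n}$ ($n\in\mathbb M_j$) be the bosonic annihilation operators on the Fock space $\mathcal H$ of the modes $(j,n)$, $n\in\mathbb M_j$. The restricted field operators are $$\tilde\Psi_j(x)=\sum_{n\in\mathbb M_j}\phi_{j,n}(x)\,a_{j,n},\qquad \tilde\Psi_j^\dagger(x)=\sum_{n\in\mathbb M_j}\phi_{j,n}(x)^*\,a_{j,n}^\dagger,$$ with their maximal domains in $\mathcal H$. A functional $F$ of $\boldsymbol\Psi=(\Psi_1,\dots,\Psi_C)\in\prod_j\mathbb F_{\mathbb M_j}$ is regarded as a function of the amplitudes $\alpha_{j,n}\in\mathbb C$ in $\Psi_j=\sum_{n\in\mathbb M_j}\phi_{j,n}\alpha_{j,n}$. Functional integration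 $\int\delta^2\boldsymbol\Psi$ is Lebesgue integration over the real and imaginary parts of all $\alpha_{j,n}$, square integrability and null sets refer to this measure, and $$\frac{\delta F}{\delta\Psi_j(x)}=\sum_{n\in\mathbb M_j}\phi_{j,n}(x)^*\frac{\partial F}{\partial\alpha_{j,n}},\qquad \frac{\delta F}{\delta\Psi_j(x)^*}=\sum_{n\in\mathbb M_j}\phi_{j,n}(x)\frac{\partial F}{\partial\alpha_{j,n}^*}$$ with Wirtinger derivatives. For a functional $F$ that is only locally integrable, $G=\delta F/\delta\Psi_j(x)$ in the weak sense means that $G$ is locally integrable and $\int\delta^2\boldsymbol\Psi\,F\,\frac{\delta\eta}{\delta\Psi_j(x)}=-\int\delta^2\boldsymbol\Psi\,G\,\eta$ for all smooth compactly supported $\eta$; similarly for $\delta/\delta\Psi_j(x)^*$. For $\Lambda_j\in\mathbb F_{\mathbb M_j}$ put $\hat D_j[\Lambda_j,\Lambda_j^*]=\exp\int_R dx\,(\Lambda_j\tilde\Psi_j^\dagger-\Lambda_j^*\tilde\Psi_j)$, and $D[\Lambda_j,\Lambda_j^*,\Psi_j,\Psi_j^*]=\exp\int_R dx\,(-\Lambda_j\Psi_j^*+\Lambda_j^*\Psi_j)$.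 For a Hilbert–Schmidt operator $A$ on $\mathcal H$ the Wigner transform is $$\mathcal W[A][\boldsymbol\Psi,\boldsymbol\Psi^*]=\frac1{\pi^{2\sum_j|\mathbb M_j|}}\int\delta^2\boldsymbol\Lambda\Big(\prod_{j=1}^C D[\Lambda_j,\Lambda_j^*,\Psi_j,\Psi_j^*]\Big)\operatorname{Tr}\Big\{A\prod_{j=1}^C\hat D_j[\Lambda_j,\Lambda_j^*]\Big\},$$ where the trace, taken over the occupation-number basis, converges in mean square as a functional of $\boldsymbol\Lambda$, and the integral is the limit in mean square, as $r\to\infty$, of the integrals over the fields all of whose amplitudes have modulus at most $r$. **Theorem.** Let $A$ be a Hilbert–Schmidt operator on $\mathcal H$. Then $\mathcal W[A]$ exists as a square-integrable functional, unique up to null sets. Moreover, for all $j$ and all $x\in\mathbb R^D$, each of the following identities holds, with functional derivatives in the weak sense, whenever the operator product on its left-hand side is a Hilbert–Schmidt operator (for $\tilde\Psi_j(x)A$ and $\tilde\Psi_j^\dagger(x)A$ this includes that $A$ maps into the domain of the field operator; $A\tilde\Psi_j(x)$ and $A\tilde\Psi_j^\dagger(x)$ stand for the bounded extension of the densely defined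 product): $$\mathcal W[\tilde\Psi_j(x)A]=\Big(\Psi_j(x)+\tfrac12\frac{\delta}{\delta\Psi_j(x)^*}\Big)\mathcal W[A],\qquad \mathcal W[\tilde\Psi_j^\dagger(x)A]=\Big(\Psi_j(x)^*-\tfrac12\frac{\delta}{\delta\Psi_j(x)}\Big)\mathcal W[A],$$ $$\mathcal W[A\tilde\Psi_j(x)]=\Big(\Psi_j(x)-\tfrac12\frac{\delta}{\delta\Psi_j(x)^*}\Big)\mathcal W[A],\qquad \mathcal W[A\tilde\Psi_j^\dagger(x)]=\Big(\Psi_j(x)^*+\tfrac12\frac{\delta}{\delta\Psi_j(x)}\Big)\mathcal W[A].$$ -/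

import Mathlib

open MeasureTheory Filter Topology
open scoped ComplexConjugate ContDiff

namespace FuncWigner

noncomputable section

/-! ### Bosonic Fock space of finitely many modes -/

/-- The bosonic Fock space of the modes `I`: square-summable families of amplitudes indexed by the
occupation numbers. -/
abbrev Fock (I : Type*) : Type _ := lp (fun _ : I → ℕ => ℂ) 2

/-- The occupation-number basis vector `|k⟩`. -/
def numberState {I : Type*} [Fintype I] [DecidableEq I] (k : I → ℕ) : Fock I := lp.single 2 k 1

/-- The annihilation operator `aₘ`, acting on arbitrary families of amplitudes;
`aₘ |k⟩ = √(kₘ) |k - 1ₘ⟩`. -/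
def annihilate {I : Type*} [DecidableEq I] (m : I) : ((I → ℕ) → ℂ) →ₗ[ℂ] ((I → ℕ) → ℂ) where
  toFun ψ k := (√(k m + 1 : ℝ) : ℂ) * ψ (k + Pi.single m 1)
  map_add' ψ χ := by ext k; simp [mul_add]
  map_smul' c ψ := by ext k; simp [mul_left_comm]

/-- The creation operator `aₘ†`, acting on arbitrary families of amplitudes;
`aₘ† |k⟩ = √(kₘ + 1) |k + 1ₘ⟩`. (The truncated subtraction is harmless: for `k m = 0` the
prefactor vanishes.) -/
def create {I : Type*} [DecidableEq I] (m : I) : ((I → ℕ) → ℂ) →ₗ[ℂ] ((I → ℕ) → ℂ) where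
  toFun ψ k := (√(k m : ℝ) : ℂ) * ψ (k - Pi.single m 1)
  map_add' ψ χ := by ext k; simp [mul_add]
  map_smul' c ψ := by ext k; simp [mul_left_comm]

/-- `T` is the bounded operator `exp X`: for every number state `|l⟩`, the amplitudes of `T |l⟩` are
the sums of the exponential series `∑ₚ Xᵖ |l⟩ / p!`. (This determines `T`, since the number states
span a dense subspace.) -/
def IsExpOf {I : Type*} [Fintype I] [DecidableEq I] (X : ((I → ℕ) → ℂ) → ((I → ℕ) → ℂ))
    (T : Fock I →L[ℂ] Fock I) : Prop :=
  ∀ l k : I → ℕ,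
    HasSum (fun p : ℕ => ((p.factorial : ℂ))⁻¹ * (X^[p] (Pi.single l 1)) k) (T (numberState l) k)

/-! ### The operators `exp (∑ₘ (cₘ aₘ† - conj cₘ aₘ))` exist -/

/-- `∑ₘ (cₘ aₘ† - conj cₘ aₘ)` on arbitrary families of amplitudes. -/
def gen {I : Type*} [Fintype I] [DecidableEq I] (c : I → ℂ) (ψ : (I → ℕ) → ℂ) (k : I → ℕ) : ℂ :=
  ∑ m, (c m * create m ψ k - conj (c m) * annihilate m ψ k)

/-- `∑ₘ (cₘ aₘ† - conj cₘ aₘ)` on finite linear combinations of number states. -/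
def genFin {I : Type*} [Fintype I] [DecidableEq I] (c : I → ℂ) :
    ((I → ℕ) →₀ ℂ) →ₗ[ℂ] ((I → ℕ) →₀ ℂ) :=
  Finsupp.linearCombination ℂ fun l : I → ℕ =>
    ∑ m, ((c m * (√(l m + 1 : ℝ) : ℂ)) • Finsupp.single (l + Pi.single m 1) (1 : ℂ)
      - (conj (c m) * (√(l m : ℝ) : ℂ)) • Finsupp.single (l - Pi.single m 1) (1 : ℂ))

theorem shift_iff {I : Type*} [DecidableEq I] (l k : I → ℕ) (m : I) :
    (l + Pi.single m 1 = k) ↔ (k m ≠ 0 ∧ l = k - Pi.single m 1) := by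
  constructor
  · rintro rfl
    refine ⟨by simp, by ext i; simp⟩
  · rintro ⟨h, rfl⟩
    ext i
    by_cases hi : i = m
    · subst hi; simp; omega
    · simp [hi]

theorem genFin_single_apply {I : Type*} [Fintype I] [DecidableEq I] (c : I → ℂ) (l k : I → ℕ) :
    genFin c (Finsupp.single l 1) k = ∑ m,
      (c m * (if l + Pi.single m 1 = k then (√(l m + 1 : ℝ) : ℂ) else 0)
        - conj (c m) * (if k + Pi.single m 1 = l then (√(l m : ℝ) : ℂ) else 0)) := by
  simp only [genFin, Finsupp.linearCombination_single, one_smul, Finsupp.finsetSum_apply,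
    Finsupp.sub_apply, Finsupp.smul_apply, Finsupp.single_apply, smul_eq_mul]
  refine Finset.sum_congr rfl fun m _ => ?_
  congr 1
  · split_ifs <;> simp
  · by_cases h0 : l m = 0
    · simp [h0]
    · have : (l - Pi.single m 1 = k) ↔ (k + Pi.single m 1 = l) := by
        rw [shift_iff]; exact ⟨fun h => ⟨h0, h.symm⟩, fun h => h.2.symm⟩
      simp only [this]
      split_ifs <;> simp

theorem genFin_single_skew {I : Type*} [Fintype I] [DecidableEq I] (c : I → ℂ) (l k : I → ℕ) :
    conj (genFin c (Finsupp.single l 1) k) = - genFin c (Finsupp.single k 1) l := by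
  rw [genFin_single_apply, genFin_single_apply, map_sum, ← Finset.sum_neg_distrib]
  refine Finset.sum_congr rfl fun m _ => ?_
  by_cases h1 : l + Pi.single m 1 = k <;> by_cases h2 : k + Pi.single m 1 = l
  · have a := congrFun h1 m
    have b := congrFun h2 m
    simp at a b; omega
  · subst h1; simp [h2]
  · subst h2; simp [h1]
  · simp [h1, h2]

theorem genFin_coe {I : Type*} [Fintype I] [DecidableEq I] (c : I → ℂ) (f : (I → ℕ) →₀ ℂ) :
    ⇑(genFin c f) = gen c ⇑f := by
  induction f using Finsupp.induction_linear with
  | zero => ext k; simp [gen]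
  | add f g hf hg =>
    ext k
    simp only [map_add, Finsupp.coe_add, Pi.add_apply, hf, hg, gen, mul_add, ← Finset.sum_add_distrib]
    exact Finset.sum_congr rfl fun m _ => by ring
  | single l a =>
    ext k
    have h : Finsupp.single l a = a • Finsupp.single l (1 : ℂ) := by simp
    have h2 : ((Finsupp.single l a : (I → ℕ) →₀ ℂ) : (I → ℕ) → ℂ) = a • (Pi.single l 1) := by
      rw [h, Finsupp.coe_smul, Finsupp.single_eq_pi_single]
    rw [h2]
    rw [h, map_smul, Finsupp.smul_apply, genFin_single_apply, smul_eq_mul, gen, Finset.mul_sum]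
    refine Finset.sum_congr rfl fun m _ => ?_
    simp only [create, annihilate, LinearMap.coe_mk, AddHom.coe_mk, Pi.smul_apply, smul_eq_mul,
      Pi.single_apply]
    by_cases h1 : l + Pi.single m 1 = k
    · have h1' := (shift_iff l k m).1 h1
      have h3 : ¬ (k + Pi.single m 1 = l) := by
        intro h; have a := congrFun h1 m; have b := congrFun h m; simp at a b; omega
      have h4 : (k m : ℝ) = l m + 1 := by rw [← h1]; simp
      rw [if_pos h1, if_neg h3, if_pos h1'.2.symm, if_neg h3, h4]; ring
    · have e1 : (√(k m : ℝ) : ℂ) * (a * if k - Pi.single m 1 = l then 1 else 0) = 0 := by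
        by_cases h0 : k m = 0
        · simp [h0]
        · rw [if_neg]
          · simp
          · intro h; exact h1 ((shift_iff l k m).2 ⟨h0, h.symm⟩)
      rw [if_neg h1, e1]
      by_cases h2 : k + Pi.single m 1 = l
      · have h4 : (l m : ℝ) = k m + 1 := by rw [← h2]; simp
        rw [if_pos h2, if_pos h2, h4]; ring
      · rw [if_neg h2, if_neg h2]; ring

theorem genFin_iterate_coe {I : Type*} [Fintype I] [DecidableEq I] (c : I → ℂ) (p : ℕ)
    (f : (I → ℕ) →₀ ℂ) : ⇑((genFin c)^[p] f) = (gen c)^[p] ⇑f := by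
  induction p generalizing f with
  | zero => rfl
  | succ p ih => rw [Function.iterate_succ_apply, Function.iterate_succ_apply, ih, genFin_coe]

/-- Finite linear combinations of number states as vectors of the Fock space. -/
def toFock {I : Type*} [Fintype I] [DecidableEq I] : ((I → ℕ) →₀ ℂ) →ₗ[ℂ] Fock I :=
  Finsupp.linearCombination ℂ numberState

theorem numberState_apply {I : Type*} [Fintype I] [DecidableEq I] (l k : I → ℕ) :
    (numberState l : Fock I) k = (Pi.single l 1 : (I → ℕ) → ℂ) k := by
  simp [numberState]

theorem toFock_apply {I : Type*} [Fintype I] [DecidableEq I] (f : (I → ℕ) →₀ ℂ) (k : I → ℕ) :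
    (toFock f : Fock I) k = f k := by
  induction f using Finsupp.induction_linear with
  | zero => simp
  | add f g hf hg => simp [hf, hg]
  | single l a =>
    rw [toFock, Finsupp.linearCombination_single, lp.coeFn_smul, Pi.smul_apply, numberState_apply,
      Finsupp.single_eq_pi_single, smul_eq_mul, Pi.single_apply, Pi.single_apply]
    simp

theorem inner_numberState {I : Type*} [Fintype I] [DecidableEq I] (l : I → ℕ) (f : Fock I) :
    inner ℂ (numberState l) f = f l := by
  rw [numberState, lp.inner_single_left]; simp

theorem inner_genFin {I : Type*} [Fintype I] [DecidableEq I] (c : I → ℂ) (f g : (I → ℕ) →₀ ℂ) :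
    inner ℂ (toFock (genFin c f)) (toFock g) = - inner ℂ (toFock f) (toFock (genFin c g)) := by
  induction f using Finsupp.induction_linear with
  | zero => simp
  | add f₁ f₂ h₁ h₂ => simp only [map_add, inner_add_left, h₁, h₂]; ring
  | single l a =>
    have h : Finsupp.single l a = a • Finsupp.single l (1 : ℂ) := by simp
    rw [h]
    simp only [map_smul, inner_smul_left]
    rw [← mul_neg]; congr 1
    have e : ∀ l : I → ℕ, (toFock (Finsupp.single l (1 : ℂ)) : Fock I) = numberState l := by
      intro l; simp [toFock]
    rw [e, inner_numberState, toFock_apply]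
    induction g using Finsupp.induction_linear with
    | zero => simp
    | add f₁ f₂ h₁ h₂ => simp only [map_add, inner_add_right, Finsupp.add_apply, h₁, h₂]; ring
    | single k b =>
      have h : Finsupp.single k b = b • Finsupp.single k (1 : ℂ) := by simp
      rw [h]
      simp only [map_smul, inner_smul_right, Finsupp.smul_apply, smul_eq_mul]
      rw [e, ← inner_conj_symm, inner_numberState, toFock_apply, genFin_single_skew]
      ring

theorem inner_genFin_iterate {I : Type*} [Fintype I] [DecidableEq I] (c : I → ℂ) (p : ℕ)
    (f g : (I → ℕ) →₀ ℂ) :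
    inner ℂ (toFock ((genFin c)^[p] f)) (toFock g)
      = (-1) ^ p * inner ℂ (toFock f) (toFock ((genFin c)^[p] g)) := by
  induction p generalizing f g with
  | zero => simp
  | succ p ih =>
    rw [Function.iterate_succ_apply, ih, inner_genFin, ← Function.iterate_succ_apply' (genFin c),
      pow_succ]; ring

/-- Growth bound for the iterates of the generator on number states. -/
theorem norm_iterate_le {I : Type*} [Fintype I] [DecidableEq I] (c : I → ℂ) (p : ℕ) (n : ℕ)
    (l : I → ℕ) (hl : ∑ m, l m ≤ n) :
    ‖(toFock ((genFin c)^[p] (Finsupp.single l 1)) : Fock I)‖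
      ≤ (2 * ∑ m, ‖c m‖) ^ p * √((n + 1).ascFactorial p : ℝ) := by
  induction p generalizing n l with
  | zero => simp [toFock, numberState, lp.norm_single]
  | succ p ih =>
    have hlin : ∀ f, (genFin c)^[p] f = ((genFin c) ^ p) f := fun f => by
      rw [Module.End.pow_apply]
    rw [Function.iterate_succ_apply]
    nth_rewrite 2 [genFin]
    rw [Finsupp.linearCombination_single, one_smul, hlin, map_sum, map_sum]
    simp only [map_sub, map_smul]
    have hS : √((n + 1 + 1).ascFactorial p : ℝ) * √(n + 1 : ℝ)
        = √((n + 1).ascFactorial (p + 1) : ℝ) := by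
      rw [← Real.sqrt_mul (by positivity)]
      congr 1
      have := Nat.succ_ascFactorial (n + 1) p
      rw [Nat.ascFactorial_succ, ← this]; push_cast; ring
    have key : ∀ m, ‖((c m * (√(l m + 1 : ℝ) : ℂ)) •
          toFock (((genFin c) ^ p) (Finsupp.single (l + Pi.single m 1) (1 : ℂ)))
        - (conj (c m) * (√(l m : ℝ) : ℂ)) •
          toFock (((genFin c) ^ p) (Finsupp.single (l - Pi.single m 1) (1 : ℂ))) : Fock I)‖
        ≤ (2 * ‖c m‖) * ((2 * ∑ m, ‖c m‖) ^ p * √((n + 1).ascFactorial (p + 1) : ℝ)) := by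
      intro m
      have hm : l m ≤ n := (Finset.single_le_sum (fun i _ => Nat.zero_le _) (Finset.mem_univ m)).trans hl
      have hmR : (l m : ℝ) ≤ n := by exact_mod_cast hm
      have b1 := ih (n + 1) (l + Pi.single m 1) (by
        simp only [Pi.add_apply, Finset.sum_add_distrib, Finset.sum_pi_single', Finset.mem_univ,
          if_true]; omega)
      have b2 := ih (n + 1) (l - Pi.single m 1) (by
        refine le_trans (Finset.sum_le_sum fun i _ => ?_) (hl.trans (Nat.le_succ n))
        simp)
      rw [hlin] at b1 b2
      refine (norm_sub_le _ _).trans ?_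
      rw [norm_smul, norm_smul, norm_mul, norm_mul, RCLike.norm_conj]
      have s1 : ‖(√(l m + 1 : ℝ) : ℂ)‖ ≤ √(n + 1 : ℝ) := by
        rw [Complex.norm_real, Real.norm_of_nonneg (Real.sqrt_nonneg _)]
        exact Real.sqrt_le_sqrt (by linarith)
      have s2 : ‖(√(l m : ℝ) : ℂ)‖ ≤ √(n + 1 : ℝ) := by
        rw [Complex.norm_real, Real.norm_of_nonneg (Real.sqrt_nonneg _)]
        exact Real.sqrt_le_sqrt (by linarith)
      have hB : 0 ≤ (2 * ∑ m, ‖c m‖) ^ p * √((n + 1 + 1).ascFactorial p : ℝ) := by positivity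
      calc _ ≤ ‖c m‖ * √(n + 1 : ℝ) * ((2 * ∑ m, ‖c m‖) ^ p * √((n + 1 + 1).ascFactorial p : ℝ))
            + ‖c m‖ * √(n + 1 : ℝ) * ((2 * ∑ m, ‖c m‖) ^ p * √((n + 1 + 1).ascFactorial p : ℝ)) := by
            gcongr
        _ = (2 * ‖c m‖) * ((2 * ∑ m, ‖c m‖) ^ p *
            (√((n + 1 + 1).ascFactorial p : ℝ) * √(n + 1 : ℝ))) := by ring
        _ = _ := by rw [hS]
    refine (norm_sum_le _ _).trans ((Finset.sum_le_sum fun m _ => key m).trans ?_)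
    rw [← Finset.sum_mul, ← Finset.mul_sum, pow_succ']
    exact le_of_eq (by ring)

theorem summable_bound (K : ℝ) (n : ℕ) :
    Summable fun p : ℕ => ((p.factorial : ℝ))⁻¹ * (K ^ p * √((n + 1).ascFactorial p : ℝ)) := by
  have h1 : Summable fun p : ℕ => (2 : ℝ) ^ n * ((8 * K ^ 2) ^ p / p.factorial) :=
    (Real.summable_pow_div_factorial _).mul_left _
  have h2 : Summable fun p : ℕ => ((1 : ℝ) / 4) ^ p :=
    summable_geometric_of_lt_one (by norm_num) (by norm_num)
  refine Summable.of_norm_bounded (h1.add h2) fun p => ?_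
  have hf : (0 : ℝ) < p.factorial := by exact_mod_cast p.factorial_pos
  have hasc : ((n + 1).ascFactorial p : ℝ) ≤ p.factorial * 2 ^ (n + p) := by
    have h : (n + 1).ascFactorial p = p.factorial * (n + p).choose p :=
      Nat.ascFactorial_eq_factorial_mul_choose n p
    rw [h]; push_cast
    gcongr
    exact_mod_cast Nat.choose_le_two_pow (n + p) p
  set s := √((n + 1).ascFactorial p : ℝ) with hs
  have hs0 : 0 ≤ s := Real.sqrt_nonneg _
  have hs2 : s ^ 2 ≤ p.factorial * 2 ^ (n + p) := by
    rw [hs, Real.sq_sqrt (by positivity)]; exact hasc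
  rw [norm_mul, norm_mul, norm_inv, Real.norm_of_nonneg hf.le, Real.norm_of_nonneg hs0, norm_pow]
  set x := ((p.factorial : ℝ))⁻¹ * (‖K‖ ^ p * s) with hx
  have hx2 : x ^ 2 ≤ (2 ^ n * ((8 * K ^ 2) ^ p / p.factorial)) * ((1 / 4 : ℝ) ^ p) := by
    have e1 : x ^ 2 = ((p.factorial : ℝ))⁻¹ ^ 2 * (K ^ 2) ^ p * s ^ 2 := by
      rw [hx, ← sq_abs K, Real.norm_eq_abs]; ring
    have e2 : ((2 : ℝ) ^ n * ((8 * K ^ 2) ^ p / p.factorial)) * ((1 / 4 : ℝ) ^ p)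
        = ((p.factorial : ℝ))⁻¹ ^ 2 * (K ^ 2) ^ p * (p.factorial * 2 ^ (n + p)) := by
      have : (8 : ℝ) ^ p * (1 / 4) ^ p = 2 ^ p := by rw [← mul_pow]; norm_num
      rw [mul_pow, pow_add, ← this]
      field_simp
    rw [e1, e2]
    gcongr
  set u := (2 : ℝ) ^ n * ((8 * K ^ 2) ^ p / p.factorial)
  set v := (1 / 4 : ℝ) ^ p
  have hu : 0 ≤ u := by positivity
  have hv : 0 ≤ v := by positivity
  refine abs_le_of_sq_le_sq' ?_ (by positivity) |>.2
  nlinarith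

theorem exists_isExpOf_gen {I : Type*} [Fintype I] [DecidableEq I] (c : I → ℂ) :
    ∃ T : Fock I →L[ℂ] Fock I, IsExpOf (gen c) T := by
  set v : (I → ℕ) → ℕ → Fock I := fun l p =>
    ((p.factorial : ℂ))⁻¹ • toFock ((genFin c)^[p] (Finsupp.single l 1)) with hv
  have hsum : ∀ l, Summable fun p => ‖v l p‖ := by
    intro l
    refine Summable.of_nonneg_of_le (fun _ => norm_nonneg _) (fun p => ?_)
      (summable_bound (2 * ∑ m, ‖c m‖) (∑ m, l m))
    rw [hv, norm_smul, norm_inv, Complex.norm_natCast]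
    gcongr
    exact norm_iterate_le c p _ l le_rfl
  have hS : ∀ l, HasSum (v l) (∑' p, v l p) := fun l => (hsum l).of_norm.hasSum
  set u : (I → ℕ) → Fock I := fun l => ∑' p, v l p with hu
  have hinner : ∀ l k, inner ℂ (u l) (u k) = (Pi.single l 1 : (I → ℕ) → ℂ) k := by
    intro l k
    set s : ℕ → ℂ := fun r => inner ℂ (toFock (Finsupp.single l 1) : Fock I)
      (toFock ((genFin c)^[r] (Finsupp.single k 1))) with hs
    have hterm : ∀ p q, inner ℂ (v l p) (v k q)
        = (-1) ^ p * ((p.factorial : ℂ))⁻¹ * ((q.factorial : ℂ))⁻¹ * s (p + q) := by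
      intro p q
      simp only [hv, inner_smul_left, inner_smul_right, inner_genFin_iterate, hs,
        Function.iterate_add_apply, map_inv₀, Complex.conj_natCast]
      ring
    have hd : Summable fun x : ℕ × ℕ => inner ℂ (v l x.1) (v k x.2) := by
      refine Summable.of_norm_bounded
        ((hsum l).mul_of_nonneg (hsum k) (fun _ => norm_nonneg _) fun _ => norm_nonneg _) fun x => ?_
      exact norm_inner_le_norm _ _
    have e1 : inner ℂ (u l) (u k) = ∑' x : ℕ × ℕ, inner ℂ (v l x.1) (v k x.2) := by
      have a1 : ∀ p, HasSum (fun q => inner ℂ (v l p) (v k q)) (inner ℂ (v l p) (u k)) :=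
        fun p => (hS k).mapL (innerSL ℂ (v l p))
      have a2 : HasSum (fun p => inner ℂ (v l p) (u k)) (inner ℂ (u l) (u k)) := by
        have := ((hS l).mapL (innerSL ℂ (u k))).star
        simpa [innerSL_apply_apply, inner_conj_symm] using this
      exact (a2.unique (HasSum.prod_fiberwise hd.hasSum a1))
    rw [e1, ← Finset.HasAntidiagonal.sigmaAntidiagonalEquivProd.tsum_eq
      (fun x : ℕ × ℕ => inner ℂ (v l x.1) (v k x.2))]
    have hd' := Finset.HasAntidiagonal.sigmaAntidiagonalEquivProd.summable_iff.2 hd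
    have e2 := hd'.tsum_sigma' fun _ => (hasSum_fintype _).summable
    refine e2.trans ?_
    have hfib : ∀ r, (∑' x : Finset.HasAntidiagonal.antidiagonal r,
        ((fun x : ℕ × ℕ => inner ℂ (v l x.1) (v k x.2)) ∘
          Finset.HasAntidiagonal.sigmaAntidiagonalEquivProd) ⟨r, x⟩)
        = (∑ x ∈ Finset.HasAntidiagonal.antidiagonal r,
            (-1 : ℂ) ^ x.1 * ((x.1.factorial : ℂ))⁻¹ * ((x.2.factorial : ℂ))⁻¹) * s r := by
      intro r
      rw [tsum_fintype, Finset.sum_mul, ← Finset.sum_coe_sort (Finset.HasAntidiagonal.antidiagonal r)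
        (fun x => (-1 : ℂ) ^ x.1 * ((x.1.factorial : ℂ))⁻¹ * ((x.2.factorial : ℂ))⁻¹ * s r)]
      refine Finset.sum_congr rfl fun x _ => ?_
      have hx := Finset.HasAntidiagonal.mem_antidiagonal.1 x.2
      simp only [Finset.HasAntidiagonal.sigmaAntidiagonalEquivProd, Equiv.coe_fn_mk, hterm, hx,
        Function.comp_apply]
    rw [tsum_congr hfib, tsum_eq_single 0]
    · simp [hs, toFock, inner_numberState, numberState_apply, Pi.single_apply, eq_comm]
    · intro r hr
      have hb : ∑ x ∈ Finset.HasAntidiagonal.antidiagonal r,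
          (-1 : ℂ) ^ x.1 * ((x.1.factorial : ℂ))⁻¹ * ((x.2.factorial : ℂ))⁻¹ = 0 := by
        have hpow := (Commute.all (-1 : ℂ) 1).add_pow' r
        rw [neg_add_cancel, zero_pow hr] at hpow
        have h3 : ∑ x ∈ Finset.HasAntidiagonal.antidiagonal r,
            (-1 : ℂ) ^ x.1 * ((x.1.factorial : ℂ))⁻¹ * ((x.2.factorial : ℂ))⁻¹
            = ((r.factorial : ℂ))⁻¹ * ∑ x ∈ Finset.HasAntidiagonal.antidiagonal r,
              r.choose x.1 • ((-1 : ℂ) ^ x.1 * 1 ^ x.2) := by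
          rw [Finset.mul_sum]
          refine Finset.sum_congr rfl fun x hx => ?_
          have hx := Finset.HasAntidiagonal.mem_antidiagonal.1 hx
          subst hx
          have h4 : (((x.1 + x.2).choose x.1 : ℕ) : ℂ) * (x.1.factorial : ℂ) * (x.2.factorial : ℂ)
              = ((x.1 + x.2).factorial : ℂ) := by
            rw [Nat.choose_symm_add]
            exact_mod_cast Nat.add_choose_mul_factorial_mul_factorial x.1 x.2
          have f1 : (x.1.factorial : ℂ) ≠ 0 := by exact_mod_cast x.1.factorial_ne_zero
          have f2 : (x.2.factorial : ℂ) ≠ 0 := by exact_mod_cast x.2.factorial_ne_zero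
          have f3 : ((x.1 + x.2).factorial : ℂ) ≠ 0 := by
            exact_mod_cast (x.1 + x.2).factorial_ne_zero
          rw [nsmul_eq_mul, one_pow, mul_one]
          field_simp
          rw [← h4]; ring
        rw [h3, ← hpow, mul_zero]
      rw [hb, zero_mul]
  have horth : Orthonormal ℂ u := by
    rw [orthonormal_iff_ite]
    intro l k
    rw [hinner, Pi.single_apply]; simp [eq_comm]
  refine ⟨horth.orthogonalFamily.linearIsometry.toContinuousLinearMap, fun l k => ?_⟩
  have hT : horth.orthogonalFamily.linearIsometry.toContinuousLinearMap (numberState l) = u l := by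
    rw [LinearIsometry.coe_toContinuousLinearMap, numberState,
      OrthogonalFamily.linearIsometry_apply_single]
    simp
  rw [hT]
  have h := (hS l).mapL (lp.evalCLM ℂ (fun _ : I → ℕ => ℂ) 2 k)
  have e : ∀ p : ℕ, (lp.evalCLM ℂ (fun _ : I → ℕ => ℂ) 2 k) (v l p)
      = ((p.factorial : ℂ))⁻¹ * ((gen c)^[p] (Pi.single l 1)) k := by
    intro p
    change (v l p) k = _
    rw [hv, lp.coeFn_smul, Pi.smul_apply, toFock_apply, genFin_iterate_coe,
      Finsupp.single_eq_pi_single, smul_eq_mul]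
  simp only [e] at h
  exact h

/-! ### Mode functions and restricted function spaces -/

/-- `C` families of mode functions `φ j n : ℝᴰ → ℂ`, `n ∈ B j`, orthonormal in `L²(region)`, and for
every component `j` the finite set `modes j` of the modes that are kept by the cutoff. -/
structure ModeSystem (C D : ℕ) (B : Fin C → Type*) where
  region : Set (EuclideanSpace ℝ (Fin D))
  measurableSet_region : MeasurableSet region
  φ : ∀ j, B j → EuclideanSpace ℝ (Fin D) → ℂ
  memLp_φ : ∀ j n, MemLp (φ j n) 2 (volume.restrict region)
  norm_φ : ∀ j n, ∫ x in region, conj (φ j n x) * φ j n x = 1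
  orthogonal_φ : ∀ j n m, n ≠ m → ∫ x in region, conj (φ j n x) * φ j m x = 0
  modes : ∀ j, Finset (B j)

namespace ModeSystem

/-- The labels `(j, n)` of all kept modes. -/
abbrev Mode {C D : ℕ} {B : Fin C → Type*} (S : ModeSystem C D B) : Type _ := Σ j, S.modes j

instance {C D : ℕ} {B : Fin C → Type*} (S : ModeSystem C D B) : DecidableEq S.Mode :=
  Classical.decEq _

/-- The space of functions that are linear combinations of the kept modes of component `j`. -/
def restrictedSpace {C D : ℕ} {B : Fin C → Type*} (S : ModeSystem C D B) (j : Fin C) :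
    Submodule ℂ (EuclideanSpace ℝ (Fin D) → ℂ) :=
  Submodule.span ℂ (Set.range fun n : S.modes j => S.φ j n)

/-- Multi-component restricted fields `Ψ = (Ψ₁, …, Ψ_C)`; functionals are functions on it. -/
abbrev Fields {C D : ℕ} {B : Fin C → Type*} (S : ModeSystem C D B) : Type _ :=
  ∀ j, S.restrictedSpace j

/-- Mode amplitudes `(α_{j,n})`. -/
abbrev Amplitudes {C D : ℕ} {B : Fin C → Type*} (S : ModeSystem C D B) : Type _ :=
  ∀ j, S.modes j → ℂ

/-- The composition transformation: `Ψ_j = ∑ₙ φ_{j,n} α_{j,n}`. -/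
def compose {C D : ℕ} {B : Fin C → Type*} (S : ModeSystem C D B) (α : S.Amplitudes) : S.Fields :=
  fun j => ⟨fun x => ∑ n : S.modes j, S.φ j n x * α j n, by
    have h : (fun x => ∑ n : S.modes j, S.φ j n x * α j n)
        = ∑ n : S.modes j, α j n • S.φ j n := by
      ext x; simp [mul_comm]
    rw [h]
    exact Submodule.sum_mem _ fun n _ =>
      Submodule.smul_mem _ _ (Submodule.subset_span (Set.mem_range_self n))⟩

/-- The decomposition transformation: `α_{j,n} = ∫ φ_{j,n}* Ψ_j`. -/
def decompose {C D : ℕ} {B : Fin C → Type*} (S : ModeSystem C D B) (Ψ : S.Fields) : S.Amplitudes :=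
  fun j n => ∫ x in S.region, conj (S.φ j n x) * (Ψ j).1 x

/-! ### Functional calculus -/

/-- Functional integration: `∫ δ²Λ F[Λ] = ∫ d²λ F(∑ₙ φₙ λₙ)`, where `d²λ` is Lebesgue measure in the
real and imaginary parts of all amplitudes. -/
def funcIntegral {C D : ℕ} {B : Fin C → Type*} (S : ModeSystem C D B) (F : S.Fields → ℂ) : ℂ :=
  ∫ α : S.Amplitudes, F (S.compose α)

/-- The amplitudes with value `z` at the mode `(j, n)` and `0` at all other modes. -/
def direction {C D : ℕ} {B : Fin C → Type*} (S : ModeSystem C D B) (j : Fin C) (n : S.modes j)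
    (z : ℂ) : S.Amplitudes :=
  letI : DecidableEq (S.modes j) := Classical.decEq _
  Pi.single j (Pi.single n z)

/-- The Wirtinger derivative `∂F/∂α_{j,n} = (∂F/∂(Re α_{j,n}) - i ∂F/∂(Im α_{j,n})) / 2` at the
field `Ψ`, of `F` as a function of the amplitudes. -/
def wirtinger {C D : ℕ} {B : Fin C → Type*} (S : ModeSystem C D B) (j : Fin C) (n : S.modes j)
    (F : S.Fields → ℂ) (Ψ : S.Fields) : ℂ :=
  (lineDeriv ℝ (fun α => F (S.compose α)) (S.decompose Ψ) (S.direction j n 1)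
    - Complex.I *
      lineDeriv ℝ (fun α => F (S.compose α)) (S.decompose Ψ) (S.direction j n Complex.I)) / 2

/-- The Wirtinger derivative `∂F/∂α_{j,n}* = (∂F/∂(Re α_{j,n}) + i ∂F/∂(Im α_{j,n})) / 2`. -/
def wirtingerConj {C D : ℕ} {B : Fin C → Type*} (S : ModeSystem C D B) (j : Fin C) (n : S.modes j)
    (F : S.Fields → ℂ) (Ψ : S.Fields) : ℂ :=
  (lineDeriv ℝ (fun α => F (S.compose α)) (S.decompose Ψ) (S.direction j n 1)
    + Complex.I *
      lineDeriv ℝ (fun α => F (S.compose α)) (S.decompose Ψ) (S.direction j n Complex.I)) / 2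

/-- The functional derivative `δF/δΨ_j(x) = ∑ₙ φ_{j,n}(x)* ∂F/∂α_{j,n}`. -/
def funcDeriv {C D : ℕ} {B : Fin C → Type*} (S : ModeSystem C D B) (j : Fin C)
    (x : EuclideanSpace ℝ (Fin D)) (F : S.Fields → ℂ) (Ψ : S.Fields) : ℂ :=
  ∑ n : S.modes j, conj (S.φ j n x) * S.wirtinger j n F Ψ

/-- The functional derivative `δF/δΨ_j(x)* = ∑ₙ φ_{j,n}(x) ∂F/∂α_{j,n}*`. -/
def funcDerivConj {C D : ℕ} {B : Fin C → Type*} (S : ModeSystem C D B) (j : Fin C)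
    (x : EuclideanSpace ℝ (Fin D)) (F : S.Fields → ℂ) (Ψ : S.Fields) : ℂ :=
  ∑ n : S.modes j, S.φ j n x * S.wirtingerConj j n F Ψ

/-- Test functionals: smooth and compactly supported in the amplitudes. -/
def IsTest {C D : ℕ} {B : Fin C → Type*} (S : ModeSystem C D B) (η : S.Fields → ℂ) : Prop :=
  ContDiff ℝ ∞ (fun α => η (S.compose α)) ∧ HasCompactSupport (fun α => η (S.compose α))

/-- Local integrability in the amplitudes. -/
def LocInt {C D : ℕ} {B : Fin C → Type*} (S : ModeSystem C D B) (F : S.Fields → ℂ) : Prop :=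
  LocallyIntegrable (fun α => F (S.compose α)) volume

/-- `G = δF/δΨ_j(x)` in the weak sense. -/
def IsWeakFuncDeriv {C D : ℕ} {B : Fin C → Type*} (S : ModeSystem C D B) (j : Fin C)
    (x : EuclideanSpace ℝ (Fin D)) (F G : S.Fields → ℂ) : Prop :=
  S.LocInt F ∧ S.LocInt G ∧ ∀ η, S.IsTest η →
    S.funcIntegral (fun Ψ => F Ψ * S.funcDeriv j x η Ψ) = - S.funcIntegral (fun Ψ => G Ψ * η Ψ)

/-- `G = δF/δΨ_j(x)*` in the weak sense. -/
def IsWeakFuncDerivConj {C D : ℕ} {B : Fin C → Type*} (S : ModeSystem C D B) (j : Fin C)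
    (x : EuclideanSpace ℝ (Fin D)) (F G : S.Fields → ℂ) : Prop :=
  S.LocInt F ∧ S.LocInt G ∧ ∀ η, S.IsTest η →
    S.funcIntegral (fun Ψ => F Ψ * S.funcDerivConj j x η Ψ)
      = - S.funcIntegral (fun Ψ => G Ψ * η Ψ)

/-- Square-integrable functionals. -/
def SqInt {C D : ℕ} {B : Fin C → Type*} (S : ModeSystem C D B) (F : S.Fields → ℂ) : Prop :=
  MemLp (fun α => F (S.compose α)) 2 volume

/-- Convergence `F i → G` of functionals in mean square. -/
def TendstoL2 {C D : ℕ} {B : Fin C → Type*} (S : ModeSystem C D B) {ι : Type*}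
    (F : ι → S.Fields → ℂ) (l : Filter ι) (G : S.Fields → ℂ) : Prop :=
  Tendsto (fun i => eLpNorm (fun α => F i (S.compose α) - G (S.compose α)) 2 volume) l (𝓝 0)

/-! ### Restricted field operators and displacement operators -/

/-- The restricted field operator `Ψ̃_j(x) = ∑ₙ φ_{j,n}(x) a_{j,n}`, on arbitrary families of
amplitudes. -/
def fieldOp {C D : ℕ} {B : Fin C → Type*} (S : ModeSystem C D B) (j : Fin C)
    (x : EuclideanSpace ℝ (Fin D)) : ((S.Mode → ℕ) → ℂ) →ₗ[ℂ] ((S.Mode → ℕ) → ℂ) :=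
  ∑ n : S.modes j, S.φ j n x • annihilate (⟨j, n⟩ : S.Mode)

/-- The adjoint `Ψ̃_j(x)† = ∑ₙ φ_{j,n}(x)* a_{j,n}†`, on arbitrary families of amplitudes. -/
def fieldOpDag {C D : ℕ} {B : Fin C → Type*} (S : ModeSystem C D B) (j : Fin C)
    (x : EuclideanSpace ℝ (Fin D)) : ((S.Mode → ℕ) → ℂ) →ₗ[ℂ] ((S.Mode → ℕ) → ℂ) :=
  ∑ n : S.modes j, conj (S.φ j n x) • create (⟨j, n⟩ : S.Mode)

/-- The exponent `∫ dx (Λ Ψ̃_j† - Λ* Ψ̃_j)` of the displacement operator, integrated amplitude by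
amplitude. -/
def displacementGen {C D : ℕ} {B : Fin C → Type*} (S : ModeSystem C D B) (j : Fin C)
    (Λ : S.restrictedSpace j) (ψ : (S.Mode → ℕ) → ℂ) (k : S.Mode → ℕ) : ℂ :=
  ∫ x in S.region, (Λ.1 x * S.fieldOpDag j x ψ k - conj (Λ.1 x) * S.fieldOp j x ψ k)

theorem memLp_of_mem {C D : ℕ} {B : Fin C → Type*} (S : ModeSystem C D B) (j : Fin C)
    (Λ : S.restrictedSpace j) : MemLp Λ.1 2 (volume.restrict S.region) := by
  obtain ⟨f, hf⟩ := Λ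
  change MemLp f 2 _
  induction hf using Submodule.span_induction with
  | mem f h => obtain ⟨n, rfl⟩ := h; exact S.memLp_φ j n
  | zero => exact MemLp.zero
  | add f g _ _ h₁ h₂ => exact h₁.add h₂
  | smul a f _ h => exact h.const_smul a

theorem displacementGen_eq {C D : ℕ} {B : Fin C → Type*} (S : ModeSystem C D B) (j : Fin C)
    (Λ : S.restrictedSpace j) :
    S.displacementGen j Λ = gen (fun m : S.Mode =>
      if m.1 = j then ∫ x in S.region, Λ.1 x * conj (S.φ m.1 m.2 x) else 0) := by
  ext ψ k
  have hΛ := S.memLp_of_mem j Λ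
  have hi : ∀ n : S.modes j, Integrable (fun x => Λ.1 x * conj (S.φ j n x))
      (volume.restrict S.region) := fun n => hΛ.integrable_mul (S.memLp_φ j n).star
  have hi' : ∀ n : S.modes j, Integrable (fun x => conj (Λ.1 x) * S.φ j n x)
      (volume.restrict S.region) := fun n => hΛ.star.integrable_mul (S.memLp_φ j n)
  have hpt : ∀ x, Λ.1 x * S.fieldOpDag j x ψ k - conj (Λ.1 x) * S.fieldOp j x ψ k
      = ∑ n : S.modes j, ((Λ.1 x * conj (S.φ j n x)) * create (⟨j, n⟩ : S.Mode) ψ k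
        - (conj (Λ.1 x) * S.φ j n x) * annihilate (⟨j, n⟩ : S.Mode) ψ k) := by
    intro x
    simp only [fieldOp, fieldOpDag, LinearMap.sum_apply, LinearMap.smul_apply, Finset.sum_apply,
      Pi.smul_apply, smul_eq_mul, Finset.mul_sum, ← Finset.sum_sub_distrib]
    exact Finset.sum_congr rfl fun n _ => by ring
  have hint : ∀ n : S.modes j, Integrable (fun x =>
      (Λ.1 x * conj (S.φ j n x)) * create (⟨j, n⟩ : S.Mode) ψ k
        - (conj (Λ.1 x) * S.φ j n x) * annihilate (⟨j, n⟩ : S.Mode) ψ k)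
      (volume.restrict S.region) :=
    fun n => ((hi n).mul_const _).sub ((hi' n).mul_const _)
  rw [displacementGen, integral_congr_ae (Eventually.of_forall hpt),
    integral_finsetSum _ fun n _ => hint n, gen, Fintype.sum_sigma, Finset.sum_eq_single j]
  · refine Finset.sum_congr rfl fun n _ => ?_
    rw [integral_sub ((hi n).mul_const _) ((hi' n).mul_const _), integral_mul_const,
      integral_mul_const, if_pos rfl, ← integral_conj]
    simp
  · intro i _ hij
    simp [hij]
  · simp

/-- The functional displacement operator `D̂_j[Λ, Λ*] = exp ∫ dx (Λ Ψ̃_j† - Λ* Ψ̃_j)`. -/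
def displacementOp {C D : ℕ} {B : Fin C → Type*} (S : ModeSystem C D B) (j : Fin C)
    (Λ : S.restrictedSpace j) : Fock S.Mode →L[ℂ] Fock S.Mode :=
  Classical.choose (show ∃ T, IsExpOf (S.displacementGen j Λ) T by
    rw [S.displacementGen_eq]; exact exists_isExpOf_gen _)

theorem isExpOf_displacementOp {C D : ℕ} {B : Fin C → Type*} (S : ModeSystem C D B) (j : Fin C)
    (Λ : S.restrictedSpace j) : IsExpOf (S.displacementGen j Λ) (S.displacementOp j Λ) :=
  Classical.choose_spec (show ∃ T, IsExpOf (S.displacementGen j Λ) T by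
    rw [S.displacementGen_eq]; exact exists_isExpOf_gen _)

/-- The product `∏_j D̂_j[Λ_j, Λ_j*]` (the factors commute). -/
def displacement {C D : ℕ} {B : Fin C → Type*} (S : ModeSystem C D B) (Λ : S.Fields) :
    Fock S.Mode →L[ℂ] Fock S.Mode :=
  (List.ofFn fun j => S.displacementOp j (Λ j)).prod

/-- The displacement functional `D[Λ, Λ*, Ψ, Ψ*] = exp ∫ dx (-Λ Ψ* + Λ* Ψ)`. -/
def displacementFunctional {C D : ℕ} {B : Fin C → Type*} (S : ModeSystem C D B) {j : Fin C}
    (Λ Ψ : S.restrictedSpace j) : ℂ :=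
  Complex.exp (∫ x in S.region, (-(Λ.1 x * conj (Ψ.1 x)) + conj (Λ.1 x) * Ψ.1 x))

end ModeSystem

/-! ### Hilbert–Schmidt operators and products with unbounded operators -/

/-- Hilbert–Schmidt operators on the Fock space. -/
def IsHilbertSchmidt {I : Type*} [Fintype I] [DecidableEq I] (A : Fock I →L[ℂ] Fock I) : Prop :=
  Summable fun k : I → ℕ => ‖A (numberState k)‖ ^ 2

/-- `P = X A`, where `X` is regarded as the operator with the maximal domain
`{ψ ∈ Fock | X ψ ∈ Fock}`: `A` maps into that domain and `P ψ = X (A ψ)` for all `ψ`. -/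
def IsLeftProduct {I : Type*} (X : ((I → ℕ) → ℂ) →ₗ[ℂ] ((I → ℕ) → ℂ))
    (A P : Fock I →L[ℂ] Fock I) : Prop :=
  ∀ ψ : Fock I, (⇑(P ψ) : (I → ℕ) → ℂ) = X ⇑(A ψ)

/-- `P = A X`, where `X` is regarded as the operator with the maximal (dense) domain
`{ψ ∈ Fock | X ψ ∈ Fock}`: `P` is the bounded operator with `P ψ = A (X ψ)` on that domain. -/
def IsRightProduct {I : Type*} (X : ((I → ℕ) → ℂ) →ₗ[ℂ] ((I → ℕ) → ℂ))
    (A P : Fock I →L[ℂ] Fock I) : Prop :=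
  ∀ ψ χ : Fock I, (⇑χ : (I → ℕ) → ℂ) = X ⇑ψ → P ψ = A χ

/-! ### The functional Wigner transformation -/

namespace ModeSystem

/-- `χ[Λ, Λ*] = Tr {A ∏_j D̂_j[Λ_j, Λ_j*]}` as a square-integrable functional of `Λ`: the trace
`∑ₖ ⟨k| A ∏_j D̂_j |k⟩` converges in mean square. -/
def IsTraceFunctional {C D : ℕ} {B : Fin C → Type*} (S : ModeSystem C D B)
    (A : Fock S.Mode →L[ℂ] Fock S.Mode) (χ : S.Fields → ℂ) : Prop :=
  S.SqInt χ ∧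
  S.TendstoL2 (fun (s : Finset (S.Mode → ℕ)) Λ =>
    ∑ k ∈ s, inner ℂ (numberState k) (A (S.displacement Λ (numberState k)))) atTop χ

/-- `W = 𝒲[A]`:
`W[Ψ, Ψ*] = π^(-2 ∑_j |M_j|) ∫ δ²Λ (∏_j D[Λ_j, Λ_j*, Ψ_j, Ψ_j*]) Tr {A ∏_j D̂_j[Λ_j, Λ_j*]}`,
where the functional integral of a square-integrable functional against the oscillating factor is
the limit in mean square of the integrals over `{|λ_{j,n}| ≤ R for all (j, n)}` as `R → ∞`. -/
def IsWignerTransform {C D : ℕ} {B : Fin C → Type*} (S : ModeSystem C D B)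
    (A : Fock S.Mode →L[ℂ] Fock S.Mode) (W : S.Fields → ℂ) : Prop :=
  S.SqInt W ∧ ∃ χ, S.IsTraceFunctional A χ ∧
    S.TendstoL2 (fun (R : ℝ) Ψ =>
      ((Real.pi : ℂ) ^ (2 * ∑ j, (S.modes j).card))⁻¹ *
        S.funcIntegral (Set.indicator {Λ | ∀ j n, ‖S.decompose Λ j n‖ ≤ R}
          fun Λ => (∏ j, S.displacementFunctional (Λ j) (Ψ j)) * χ Λ)) atTop W

end ModeSystem

end
end FuncWigner

/-!
The matrix elements `⟨k| D(λ) |l⟩` of a displacement operator are, mode by mode, complex Hermite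
polynomials times the Gaussian `exp (-|λ|² / 2)`: the amplitudes of `exp (t X) |l⟩` are entire in
`t`, solve `ψ' = X ψ`, and hence have the exponential series as their Taylor series
(`IsExpOf.apply_numberState`). They are Schwartz functions of the amplitudes `λ`, on which creation
and annihilation operators act through multiplication by `λ`, `λ*` and the Wirtinger derivatives.
Integration by parts with these ladder relations shows that the matrix elements are pairwise
orthogonal in `L²` and all of the same norm (`orthonormal_dispL2`). Since the matrix elements of a
Hilbert–Schmidt operator are square summable, the trace `∑ₖₗ ⟨k|A|l⟩ ⟨l|D(λ)|k⟩` converges in mean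
square (`tendsto_trace`).

The displacement functional is a Fourier character in the coordinates `i α / π`. On the boxes
`|λ| ≤ R` the defining integral of the Wigner transform is therefore the Fourier integral of a
cut-off, and by Plancherel these converge to the `L²` Fourier transform. This identifies the Wigner
transform of `A`, up to null sets, with `wignerFun (traceL2 A)` (`isWignerTransform_iff`), which
gives existence and uniqueness.

The operator identities are proved by duality. Against a Schwartz function `f`, the Wigner transform
of `P` is, up to a constant, `∑ₖₗ ⟨k|P|l⟩ ∫ ⟨l|D(λ)|k⟩ g(λ)` with `g` the symplectic Fourier
transform of `f`. If `P` is the product of `A` with a field operator, the matrix elements of `P`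
are weighted shifts of those of `A`. Transposing the shift turns it into a ladder operator on
`⟨l|D(λ)|k⟩`, then, by integration by parts, into a first-order operator acting on `g`, and finally
into multiplication by an amplitude and a Wirtinger derivative acting on `f` (the lemma
`integral_wignerFun_fieldOp_left` and its three companions). The series for `P` against `g` and the
one for `A` against the transform of the new test function converge because `P` and `A` are
Hilbert–Schmidt; their terms are related by the shift, so the sums agree. The remaining derivative
of `f` is what the weak functional derivative means.
-/

namespace FuncWigner

noncomputable section

open scoped SchwartzMap LineDeriv FourierTransform ENNReal

/-! ### Matrix elements of displacement operators -/

/-- The complex Hermite (Itô) polynomials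
`H_{k,l}(z, w) = ∑ⱼ j! (k choose j) (l choose j) z^(k-j) w^(l-j)`, defined through the recursion in
the first index. -/
def complexHermite : ℕ → ℕ → ℂ → ℂ → ℂ
  | 0, l => fun _ w => w ^ l
  | k + 1, l => fun z w => z * complexHermite k l z w + l * complexHermite k (l - 1) z w

theorem complexHermite_succ_left (k l : ℕ) (z w : ℂ) : complexHermite (k + 1) l z w
    = z * complexHermite k l z w + l * complexHermite k (l - 1) z w := rfl

theorem complexHermite_succ_right (k l : ℕ) (z w : ℂ) : complexHermite k (l + 1) z w
    = w * complexHermite k l z w + k * complexHermite (k - 1) l z w := by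
  induction k generalizing l with
  | zero => simp [complexHermite, pow_succ']
  | succ k ih =>
    rw [complexHermite_succ_left, complexHermite_succ_left, ih, Nat.add_sub_cancel,
      Nat.add_sub_cancel]
    have hk : (k : ℂ) * complexHermite k l z w
        = k * (z * complexHermite (k - 1) l z w + l * complexHermite (k - 1) (l - 1) z w) := by
      cases k with
      | zero => simp
      | succ k => rw [complexHermite_succ_left]; rfl
    have hl : (l : ℂ) * complexHermite k l z w
        = l * (w * complexHermite k (l - 1) z w + k * complexHermite (k - 1) (l - 1) z w) := by
      cases l with
      | zero => simp
      | succ l => rw [ih]; rfl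
    push_cast
    linear_combination hl - hk

theorem hasDerivAt_complexHermite {𝕜 : Type*} [NontriviallyNormedField 𝕜] [NormedAlgebra 𝕜 ℂ]
    {z w : 𝕜 → ℂ} {z' w' : ℂ} {s : 𝕜} (hz : HasDerivAt z z' s) (hw : HasDerivAt w w' s)
    (k l : ℕ) :
    HasDerivAt (fun s => complexHermite k l (z s) (w s))
      (z' * (k * complexHermite (k - 1) l (z s) (w s))
        + w' * (l * complexHermite k (l - 1) (z s) (w s))) s := by
  induction k generalizing l with
  | zero =>
    refine (hw.fun_pow l).congr_deriv ?_
    simp only [complexHermite, CharP.cast_eq_zero, zero_mul, mul_zero, zero_add]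
    ring
  | succ k ih =>
    have h := (hz.mul (ih l)).add ((ih (l - 1)).const_mul (l : ℂ))
    have hk : (k : ℂ) * complexHermite k l (z s) (w s)
        = k * (z s * complexHermite (k - 1) l (z s) (w s)
          + l * complexHermite (k - 1) (l - 1) (z s) (w s)) := by
      cases k with
      | zero => simp
      | succ k => rw [complexHermite_succ_left]; rfl
    refine h.congr_deriv ?_
    rw [complexHermite_succ_left, Nat.add_sub_cancel]
    push_cast
    linear_combination - z' * hk

/-- `⟨k| exp (z a† + w a) |l⟩` for a single mode. The displacement operator is the case
`w = -conj z`; independent `z`, `w` make the matrix element a holomorphic function. -/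
def modeElement (z w : ℂ) (k l : ℕ) : ℂ :=
  complexHermite k l z w * Complex.exp (z * w / 2) / (√(k.factorial : ℝ) * √(l.factorial : ℝ) : ℝ)

theorem sqrt_factorial_succ (k : ℕ) :
    ((√((k + 1).factorial : ℝ) : ℝ) : ℂ) = √(k + 1 : ℝ) * √(k.factorial : ℝ) := by
  rw [Nat.factorial_succ, Nat.cast_mul, Real.sqrt_mul (by positivity)]
  push_cast; rfl

theorem sqrt_factorial_ne_zero (k : ℕ) : ((√(k.factorial : ℝ) : ℝ) : ℂ) ≠ 0 := by
  have : (0 : ℝ) < k.factorial := by exact_mod_cast k.factorial_pos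
  exact_mod_cast (Real.sqrt_pos.2 this).ne'

theorem sqrt_mul_self_complex (k : ℕ) : ((√(k : ℝ) : ℝ) : ℂ) * √(k : ℝ) = k := by
  rw [← Complex.ofReal_mul, Real.mul_self_sqrt (by positivity)]; simp

theorem sqrt_mul_modeElement_left (z w : ℂ) (k l : ℕ) :
    (√(k : ℝ) : ℂ) * modeElement z w (k - 1) l = k * complexHermite (k - 1) l z w *
      Complex.exp (z * w / 2) / (√(k.factorial : ℝ) * √(l.factorial : ℝ) : ℝ) := by
  cases k with
  | zero => simp
  | succ k =>
    have h := sqrt_mul_self_complex (k + 1)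
    have h1 : ((√((k + 1 : ℕ) : ℝ) : ℝ) : ℂ) ≠ 0 := by
      intro h0; rw [h0] at h; norm_cast at h
    simp only [modeElement, Nat.add_sub_cancel]
    push_cast [sqrt_factorial_succ] at h h1 ⊢
    have := sqrt_factorial_ne_zero k
    have := sqrt_factorial_ne_zero l
    rw [← h]
    field_simp

theorem sqrt_mul_modeElement_right (z w : ℂ) (k l : ℕ) :
    (√(l : ℝ) : ℂ) * modeElement z w k (l - 1) = l * complexHermite k (l - 1) z w *
      Complex.exp (z * w / 2) / (√(k.factorial : ℝ) * √(l.factorial : ℝ) : ℝ) := by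
  cases l with
  | zero => simp
  | succ l =>
    have h := sqrt_mul_self_complex (l + 1)
    have h1 : ((√((l + 1 : ℕ) : ℝ) : ℝ) : ℂ) ≠ 0 := by
      intro h0; rw [h0] at h; norm_cast at h
    simp only [modeElement, Nat.add_sub_cancel]
    push_cast [sqrt_factorial_succ] at h h1 ⊢
    have := sqrt_factorial_ne_zero k
    have := sqrt_factorial_ne_zero l
    rw [← h]
    field_simp

theorem sqrt_succ_ne_zero (k : ℕ) : ((√(k + 1 : ℝ) : ℝ) : ℂ) ≠ 0 := by
  have : (0 : ℝ) < k + 1 := by positivity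
  exact_mod_cast (Real.sqrt_pos.2 this).ne'

theorem sqrt_succ_mul_self_complex (k : ℕ) : ((√(k + 1 : ℝ) : ℝ) : ℂ) * √(k + 1 : ℝ) = k + 1 := by
  have := sqrt_mul_self_complex (k + 1)
  push_cast at this; exact this

theorem modeElement_succ_left (z w : ℂ) (k l : ℕ) :
    (√(k + 1 : ℝ) : ℂ) * modeElement z w (k + 1) l
      = z * modeElement z w k l + (√(l : ℝ) : ℂ) * modeElement z w k (l - 1) := by
  rw [sqrt_mul_modeElement_right, modeElement, modeElement, complexHermite_succ_left]
  push_cast [sqrt_factorial_succ]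
  have := sqrt_succ_ne_zero k
  have := sqrt_factorial_ne_zero k
  have := sqrt_factorial_ne_zero l
  field_simp

theorem modeElement_succ_right (z w : ℂ) (k l : ℕ) :
    (√(l + 1 : ℝ) : ℂ) * modeElement z w k (l + 1)
      = w * modeElement z w k l + (√(k : ℝ) : ℂ) * modeElement z w (k - 1) l := by
  rw [sqrt_mul_modeElement_left, modeElement, modeElement, complexHermite_succ_right]
  push_cast [sqrt_factorial_succ]
  have := sqrt_succ_ne_zero l
  have := sqrt_factorial_ne_zero k
  have := sqrt_factorial_ne_zero l
  field_simp

theorem hasDerivAt_modeElement {𝕜 : Type*} [NontriviallyNormedField 𝕜] [NormedAlgebra 𝕜 ℂ]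
    {z w : 𝕜 → ℂ} {z' w' : ℂ} {s : 𝕜} (hz : HasDerivAt z z' s) (hw : HasDerivAt w w' s)
    (k l : ℕ) :
    HasDerivAt (fun s => modeElement (z s) (w s) k l)
      (z' * ((√(k : ℝ) : ℂ) * modeElement (z s) (w s) (k - 1) l
          + w s / 2 * modeElement (z s) (w s) k l)
        + w' * ((√(l : ℝ) : ℂ) * modeElement (z s) (w s) k (l - 1)
          + z s / 2 * modeElement (z s) (w s) k l)) s := by
  have h1 := (hasDerivAt_complexHermite hz hw k l).mul
    (((hz.mul hw).div_const 2).cexp)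
  refine (h1.div_const ((√(k.factorial : ℝ) * √(l.factorial : ℝ) : ℝ) : ℂ)).congr_deriv ?_
  rw [sqrt_mul_modeElement_left, sqrt_mul_modeElement_right, modeElement]
  simp only [Pi.mul_apply]
  ring

theorem modeElement_zero (k l : ℕ) : modeElement 0 0 k l = if k = l then 1 else 0 := by
  have h : ∀ k l, complexHermite k l 0 0 = if k = l then (k.factorial : ℂ) else 0 := by
    intro k
    induction k with
    | zero => intro l; cases l <;> simp [complexHermite]
    | succ k ih =>
      intro l
      rw [complexHermite_succ_left, ih, ih]
      cases l with
      | zero => simp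
      | succ l =>
        by_cases hkl : k = l
        · subst hkl; simp [Nat.factorial_succ]
        · simp [hkl]
  rw [modeElement, h]
  split_ifs with hkl
  · subst hkl
    rw [Real.mul_self_sqrt (by positivity)]
    have : (k.factorial : ℂ) ≠ 0 := by exact_mod_cast k.factorial_ne_zero
    simp [this]
  · simp

theorem complexHermite_swap_neg (k l : ℕ) (z w : ℂ) :
    complexHermite k l (-w) (-z) = (-1) ^ (k + l) * complexHermite l k z w := by
  induction k generalizing l with
  | zero =>
    have : ∀ l, complexHermite l 0 z w = z ^ l := by
      intro l
      induction l with
      | zero => simp [complexHermite]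
      | succ l ih => rw [complexHermite_succ_left, ih]; simp [pow_succ']
    rw [this, zero_add, ← mul_pow]; simp [complexHermite]
  | succ k ih =>
    rw [complexHermite_succ_left, ih, ih, complexHermite_succ_right]
    cases l with
    | zero => simp [pow_succ]; ring
    | succ l => simp only [Nat.add_sub_cancel]; push_cast; ring

theorem conj_complexHermite (k l : ℕ) (z w : ℂ) :
    conj (complexHermite k l z w) = complexHermite k l (conj z) (conj w) := by
  induction k generalizing l with
  | zero => simp [complexHermite]
  | succ k ih => simp [complexHermite_succ_left, ih]

/-- Unitarity of the displacement operator, `D(z)† = D(-z)`, together with the parity of its matrix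
elements. -/
theorem conj_modeElement (z : ℂ) (k l : ℕ) :
    conj (modeElement z (-conj z) k l) = (-1) ^ (k + l) * modeElement z (-conj z) l k := by
  have h := complexHermite_swap_neg k l z (-conj z)
  rw [neg_neg] at h
  rw [modeElement, modeElement, map_div₀, map_mul, conj_complexHermite, map_neg, Complex.conj_conj,
    h, ← Complex.exp_conj, Complex.conj_ofReal]
  have e : conj (z * -conj z / 2) = z * -conj z / 2 := by
    rw [map_div₀, map_mul, map_neg, Complex.conj_conj, Complex.conj_ofNat]; ring
  rw [e, mul_comm (√(k.factorial : ℝ))]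
  ring

/-- `⟨k| exp ∑ₘ (zₘ aₘ† + wₘ aₘ) |l⟩`. -/
def dispElement {I : Type*} [Fintype I] (z w : I → ℂ) (k l : I → ℕ) : ℂ :=
  ∏ m, modeElement (z m) (w m) (k m) (l m)

theorem dispElement_zero {I : Type*} [Fintype I] (k l : I → ℕ) :
    dispElement 0 0 k l = (Pi.single l 1 : (I → ℕ) → ℂ) k := by
  rw [Pi.single_apply, dispElement]
  simp only [Pi.zero_apply, modeElement_zero]
  split_ifs with h
  · subst h; simp
  · obtain ⟨m, hm⟩ := Function.ne_iff.1 h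
    exact Finset.prod_eq_zero (Finset.mem_univ m) (by simp [hm])

theorem conj_dispElement {I : Type*} [Fintype I] (c : I → ℂ) (k l : I → ℕ) :
    conj (dispElement c (fun m => -conj (c m)) k l)
      = (-1) ^ (∑ m, k m + ∑ m, l m) * dispElement c (fun m => -conj (c m)) l k := by
  rw [dispElement, map_prod, dispElement, ← Finset.sum_add_distrib, ← Finset.prod_pow_eq_pow_sum,
    ← Finset.prod_mul_distrib]
  exact Finset.prod_congr rfl fun m _ => conj_modeElement _ _ _

section Multimode

variable {I : Type*} [Fintype I] [DecidableEq I]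

theorem prod_erase_mul_modeElement (z w : I → ℂ) {k l k' l' : I → ℕ} (m : I)
    (hk : ∀ i, i ≠ m → k i = k' i) (hl : ∀ i, i ≠ m → l i = l' i) :
    (∏ i ∈ Finset.univ.erase m, modeElement (z i) (w i) (k i) (l i))
      * modeElement (z m) (w m) (k' m) (l' m) = dispElement z w k' l' := by
  rw [dispElement, ← Finset.prod_erase_mul _ _ (Finset.mem_univ m)]
  congr 1
  refine Finset.prod_congr rfl fun i hi => ?_
  rw [hk i (Finset.ne_of_mem_erase hi), hl i (Finset.ne_of_mem_erase hi)]

omit [Fintype I] in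
theorem sub_single_of_ne (k : I → ℕ) {m i : I} (h : i ≠ m) :
    k i = (k - Pi.single m 1 : I → ℕ) i := by
  simp [h]

omit [Fintype I] in
theorem add_single_of_ne (k : I → ℕ) {m i : I} (h : i ≠ m) :
    k i = (k + Pi.single m 1 : I → ℕ) i := by
  simp [h]

theorem dispElement_add_left (z w : I → ℂ) (k l : I → ℕ) (m : I) :
    (√(k m + 1 : ℝ) : ℂ) * dispElement z w (k + Pi.single m 1) l
      = z m * dispElement z w k l + (√(l m : ℝ) : ℂ) * dispElement z w k (l - Pi.single m 1) := by
  rw [← prod_erase_mul_modeElement z w (k := k) (l := l) m (fun i hi => add_single_of_ne k hi)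
    (fun i _ => rfl), ← prod_erase_mul_modeElement z w (k := k) (l := l) m (fun i hi => rfl)
    (fun i _ => rfl), ← prod_erase_mul_modeElement z w (k := k) (l := l) m (fun i hi => rfl)
    (fun i hi => sub_single_of_ne l hi)]
  have := modeElement_succ_left (z m) (w m) (k m) (l m)
  simp only [Pi.add_apply, Pi.sub_apply, Pi.single_eq_same]
  linear_combination (∏ i ∈ Finset.univ.erase m, modeElement (z i) (w i) (k i) (l i)) * this

theorem dispElement_add_right (z w : I → ℂ) (k l : I → ℕ) (m : I) :
    (√(l m + 1 : ℝ) : ℂ) * dispElement z w k (l + Pi.single m 1)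
      = w m * dispElement z w k l + (√(k m : ℝ) : ℂ) * dispElement z w (k - Pi.single m 1) l := by
  rw [← prod_erase_mul_modeElement z w (k := k) (l := l) m (fun i _ => rfl)
    (fun i hi => add_single_of_ne l hi), ← prod_erase_mul_modeElement z w (k := k) (l := l) m
    (fun i hi => rfl) (fun i _ => rfl), ← prod_erase_mul_modeElement z w (k := k) (l := l) m
    (fun i hi => sub_single_of_ne k hi) (fun i hi => rfl)]
  have := modeElement_succ_right (z m) (w m) (k m) (l m)
  simp only [Pi.add_apply, Pi.sub_apply, Pi.single_eq_same]
  linear_combination (∏ i ∈ Finset.univ.erase m, modeElement (z i) (w i) (k i) (l i)) * this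

theorem hasDerivAt_dispElement {𝕜 : Type*} [NontriviallyNormedField 𝕜] [NormedAlgebra 𝕜 ℂ]
    {z w : 𝕜 → I → ℂ} {z' w' : I → ℂ} {s : 𝕜} (hz : ∀ m, HasDerivAt (fun s => z s m) (z' m) s)
    (hw : ∀ m, HasDerivAt (fun s => w s m) (w' m) s) (k l : I → ℕ) :
    HasDerivAt (fun s => dispElement (z s) (w s) k l)
      (∑ m, (z' m * ((√(k m : ℝ) : ℂ) * dispElement (z s) (w s) (k - Pi.single m 1) l
          + w s m / 2 * dispElement (z s) (w s) k l)
        + w' m * ((√(l m : ℝ) : ℂ) * dispElement (z s) (w s) k (l - Pi.single m 1)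
          + z s m / 2 * dispElement (z s) (w s) k l))) s := by
  refine (HasDerivAt.fun_finsetProd (u := Finset.univ)
    fun m _ => hasDerivAt_modeElement (hz m) (hw m) (k m) (l m)).congr_deriv ?_
  refine Finset.sum_congr rfl fun m _ => ?_
  rw [← prod_erase_mul_modeElement (z s) (w s) (k := k) (l := l) m
    (fun i hi => sub_single_of_ne k hi) (fun i _ => rfl),
    ← prod_erase_mul_modeElement (z s) (w s) (k := k) (l := l) m (fun i hi => rfl)
    (fun i _ => rfl), ← prod_erase_mul_modeElement (z s) (w s) (k := k) (l := l) m (fun i hi => rfl)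
    (fun i hi => sub_single_of_ne l hi), smul_eq_mul]
  simp only [Pi.sub_apply, Pi.single_eq_same]
  ring

/-- The amplitudes of `exp (t X) |l⟩`, `X = ∑ₘ (cₘ aₘ† - conj cₘ aₘ)`, solve `ψ' = X ψ`. -/
theorem hasDerivAt_dispElement_gen (c : I → ℂ) (k l : I → ℕ) (t : ℂ) :
    HasDerivAt (fun t : ℂ => dispElement (fun m => t * c m) (fun m => t * -conj (c m)) k l)
      (gen c (fun k => dispElement (fun m => t * c m) (fun m => t * -conj (c m)) k l) k) t := by
  have h := hasDerivAt_dispElement (𝕜 := ℂ) (z := fun t m => t * c m)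
    (w := fun t m => t * -conj (c m)) (z' := c) (w' := fun m => -conj (c m)) (s := t)
    (fun m => by simpa using (hasDerivAt_id t).mul_const (c m))
    (fun m => by simpa using (hasDerivAt_id t).mul_const (-conj (c m))) k l
  refine h.congr_deriv ?_
  rw [gen]
  refine Finset.sum_congr rfl fun m _ => ?_
  simp only [create, annihilate, LinearMap.coe_mk, AddHom.coe_mk]
  rw [dispElement_add_left]
  ring

theorem hasDerivAt_gen (c : I → ℂ) {ψ : ℂ → (I → ℕ) → ℂ} {ψ' : (I → ℕ) → ℂ} {t : ℂ}
    (h : ∀ k, HasDerivAt (fun t => ψ t k) (ψ' k) t) (k : I → ℕ) :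
    HasDerivAt (fun t => gen c (ψ t) k) (gen c ψ' k) t := by
  simp only [gen, create, annihilate, LinearMap.coe_mk, AddHom.coe_mk]
  exact HasDerivAt.fun_sum fun m _ =>
    (((h _).const_mul _).const_mul _).sub (((h _).const_mul _).const_mul _)

theorem hasDerivAt_gen_iterate (c : I → ℂ) (p : ℕ) {ψ : ℂ → (I → ℕ) → ℂ} {ψ' : (I → ℕ) → ℂ} {t : ℂ}
    (h : ∀ k, HasDerivAt (fun t => ψ t k) (ψ' k) t) (k : I → ℕ) :
    HasDerivAt (fun t => (gen c)^[p] (ψ t) k) ((gen c)^[p] ψ' k) t := by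
  induction p generalizing ψ ψ' with
  | zero => exact h k
  | succ p ih =>
    simp only [Function.iterate_succ_apply]
    exact ih (ψ := fun t => gen c (ψ t)) fun k => hasDerivAt_gen c h k

/-- The matrix elements of a displacement operator: `t ↦ ⟨k| exp (t X) |l⟩` is entire, and its
Taylor series at `0` is the exponential series. -/
theorem IsExpOf.apply_numberState {c : I → ℂ} {T : Fock I →L[ℂ] Fock I} (hT : IsExpOf (gen c) T)
    (l k : I → ℕ) : T (numberState l) k = dispElement c (fun m => -conj (c m)) k l := by
  set F : ℂ → (I → ℕ) → ℂ := fun t k =>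
    dispElement (fun m => t * c m) (fun m => t * -conj (c m)) k l with hF
  have hF' : ∀ t k, HasDerivAt (fun t => F t k) (gen c (F t) k) t := fun t k =>
    hasDerivAt_dispElement_gen c k l t
  have hiter : ∀ p, iteratedDeriv p (fun t => F t k) = fun t => (gen c)^[p] (F t) k := by
    intro p
    induction p with
    | zero => simp
    | succ p ih =>
      rw [iteratedDeriv_succ, ih]
      ext t
      rw [Function.iterate_succ_apply]
      exact (hasDerivAt_gen_iterate c p (hF' t) k).deriv
  have h0 : F 0 = Pi.single l 1 := by
    ext k
    simp only [hF, zero_mul]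
    exact dispElement_zero k l
  have hs := Complex.hasSum_taylorSeries_of_entire (f := fun t => F t k)
    (fun t => (hF' t k).differentiableAt) 0 1
  simp only [hiter, h0, sub_zero, one_pow, smul_eq_mul] at hs
  refine (hT l k).unique ?_
  simpa [hF] using hs

theorem hasSum_numberState (f : Fock I) : HasSum (fun q => f q • (numberState q : Fock I)) f := by
  have := lp.hasSum_single (E := fun _ : I → ℕ => ℂ) (p := 2) (by simp) f
  refine this.congr_fun fun q => ?_
  ext k
  simp [numberState, lp.single_apply, Pi.single_apply]

theorem hasSum_apply (A : Fock I →L[ℂ] Fock I) (f : Fock I) (k : I → ℕ) :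
    HasSum (fun q => f q * A (numberState q) k) (A f k) := by
  have h := ((hasSum_numberState f).mapL A).mapL (lp.evalCLM ℂ (fun _ : I → ℕ => ℂ) 2 k)
  refine h.congr_fun fun q => ?_
  rw [map_smul, map_smul]; rfl

/-- Displacements of disjoint sets of modes: only one intermediate number state contributes to the
matrix elements of their product. -/
theorem dispElement_mul_of_disjoint {T T' : Fock I →L[ℂ] Fock I} {c c' : I → ℂ}
    (hT : ∀ l k, T (numberState l) k = dispElement c (fun m => -conj (c m)) k l)
    (hT' : ∀ l k, T' (numberState l) k = dispElement c' (fun m => -conj (c' m)) k l)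
    (hc : ∀ m, c m = 0 ∨ c' m = 0) (l k : I → ℕ) :
    (T * T') (numberState l) k
      = dispElement (c + c') (fun m => -conj ((c + c') m)) k l := by
  have h := hasSum_apply T (T' (numberState l)) k
  simp only [hT, hT'] at h
  set q : I → ℕ := fun m => if c m = 0 then k m else l m with hq
  refine (h.unique (hasSum_single q fun q' hq' => ?_)).trans ?_
  · obtain ⟨m, hm⟩ := Function.ne_iff.1 hq'
    by_cases h0 : c m = 0
    · rw [dispElement, dispElement,
        Finset.prod_eq_zero (f := fun i => modeElement (c i) (-conj (c i)) (k i) (q' i))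
          (Finset.mem_univ m), mul_zero]
      simp only [hq, h0, if_true] at hm
      rw [h0, map_zero, neg_zero, modeElement_zero, if_neg (Ne.symm hm)]
    · have h1 := (hc m).resolve_left h0
      rw [dispElement,
        Finset.prod_eq_zero (f := fun i => modeElement (c' i) (-conj (c' i)) (q' i) (l i))
          (Finset.mem_univ m), zero_mul]
      simp only [hq, h0, if_false] at hm
      rw [h1, map_zero, neg_zero, modeElement_zero, if_neg hm]
  · rw [dispElement, dispElement, dispElement, ← Finset.prod_mul_distrib]
    refine Finset.prod_congr rfl fun m _ => ?_
    by_cases h0 : c m = 0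
    · simp [hq, h0, modeElement_zero]
    · have h1 := (hc m).resolve_left h0
      simp [hq, h0, h1, modeElement_zero]

end Multimode

/-! ### Fields and amplitudes -/

namespace ModeSystem

variable {C D : ℕ} {B : Fin C → Type*} (S : ModeSystem C D B)

theorem integral_conj_φ_mul_φ (j : Fin C) (n m : B j) [Decidable (n = m)] :
    ∫ x in S.region, conj (S.φ j n x) * S.φ j m x = if n = m then 1 else 0 := by
  split_ifs with h
  · subst h; exact S.norm_φ j n
  · exact S.orthogonal_φ j n m h

theorem integrable_conj_φ_mul_φ (j : Fin C) (n m : B j) :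
    Integrable (fun x => conj (S.φ j n x) * S.φ j m x) (volume.restrict S.region) :=
  (S.memLp_φ j n).star.integrable_mul (S.memLp_φ j m)

theorem decompose_compose (α : S.Amplitudes) : S.decompose (S.compose α) = α := by
  classical
  ext j n
  simp only [decompose, compose, Finset.mul_sum, ← mul_assoc]
  rw [integral_finsetSum Finset.univ (f := fun (m : S.modes j) x =>
    conj (S.φ j n x) * S.φ j m x * α j m) fun m _ => (S.integrable_conj_φ_mul_φ j n m).mul_const _]
  simp only [integral_mul_const, S.integral_conj_φ_mul_φ]
  rw [Finset.sum_eq_single n]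
  · simp
  · intro m _ hm
    rw [if_neg, zero_mul]
    exact fun h => hm (Subtype.ext h.symm)
  · simp

/-- The displacement functional in terms of amplitudes. -/
theorem displacementFunctional_compose (l α : S.Amplitudes) (j : Fin C) :
    S.displacementFunctional (S.compose l j) (S.compose α j)
      = Complex.exp (∑ n, (-(l j n * conj (α j n)) + conj (l j n) * α j n)) := by
  classical
  rw [displacementFunctional]
  congr 1
  have hΛ := S.memLp_of_mem j (S.compose l j)
  have hΨ := S.memLp_of_mem j (S.compose α j)
  have h1 : ∫ x in S.region, conj ((S.compose l j).1 x) * (S.compose α j).1 x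
      = ∑ n, conj (l j n) * α j n := by
    have e : ∀ x, conj ((S.compose l j).1 x) * (S.compose α j).1 x
        = ∑ n : S.modes j, conj (l j n) * (conj (S.φ j n x) * (S.compose α j).1 x) := by
      intro x
      have : (S.compose l j).1 x = ∑ n : S.modes j, S.φ j n x * l j n := rfl
      rw [this, map_sum, Finset.sum_mul]
      exact Finset.sum_congr rfl fun n _ => by rw [map_mul]; ring
    simp only [e]
    rw [integral_finsetSum Finset.univ (f := fun (n : S.modes j) x =>
      conj (l j n) * (conj (S.φ j n x) * (S.compose α j).1 x)) fun n _ =>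
      ((S.memLp_φ j n).star.integrable_mul hΨ).const_mul _]
    refine Finset.sum_congr rfl fun n _ => ?_
    rw [integral_const_mul]
    congr 1
    exact congrFun (congrFun (S.decompose_compose α) j) n
  have h2 : ∫ x in S.region, (S.compose l j).1 x * conj ((S.compose α j).1 x)
      = ∑ n, l j n * conj (α j n) := by
    have := congrArg conj h1
    rw [← integral_conj, map_sum] at this
    simpa using this
  rw [integral_add (f := fun x => -((S.compose l j).1 x * conj ((S.compose α j).1 x)))
    (g := fun x => conj ((S.compose l j).1 x) * (S.compose α j).1 x)
    (hΛ.integrable_mul hΨ.star).neg (hΛ.star.integrable_mul hΨ), Finset.sum_add_distrib, ← h1,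
    Finset.sum_neg_distrib, ← h2, integral_neg]

/-- The matrix elements of the functional displacement operator. -/
theorem displacement_compose_numberState (α : S.Amplitudes) (l k : S.Mode → ℕ) :
    S.displacement (S.compose α) (numberState l) k
      = dispElement (fun m : S.Mode => α m.1 m.2) (fun m => -conj (α m.1 m.2)) k l := by
  classical
  have hj : ∀ j, ∀ l k, S.displacementOp j (S.compose α j) (numberState l) k
      = dispElement (fun m : S.Mode => if m.1 = j then α m.1 m.2 else 0)
        (fun m => -conj (if m.1 = j then α m.1 m.2 else 0)) k l := by
    intro j l k
    have h := S.isExpOf_displacementOp j (S.compose α j)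
    rw [S.displacementGen_eq] at h
    rw [h.apply_numberState]
    have e : (fun m : S.Mode => if m.1 = j then
        ∫ x in S.region, (S.compose α j).1 x * conj (S.φ m.1 m.2 x) else 0)
        = fun m : S.Mode => if m.1 = j then α m.1 m.2 else 0 := by
      ext m
      split_ifs with hm
      · subst hm
        rw [← congrFun (congrFun (S.decompose_compose α) m.1) m.2, decompose]
        simp only [mul_comm]
      · rfl
    have e' := congrFun e
    simp only [e']
  have hL : ∀ L : List (Fin C), L.Nodup → ∀ l k,
      (L.map fun j => S.displacementOp j (S.compose α j)).prod (numberState l) k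
        = dispElement (fun m : S.Mode => if m.1 ∈ L then α m.1 m.2 else 0)
        (fun m => -conj (if m.1 ∈ L then α m.1 m.2 else 0)) k l := by
    intro L hL
    induction L with
    | nil =>
      intro l k
      simp only [List.map_nil, List.prod_nil, List.not_mem_nil, if_false, map_zero, neg_zero]
      exact (numberState_apply l k).trans (dispElement_zero k l).symm
    | cons j L ih =>
      intro l k
      rw [List.nodup_cons] at hL
      have h := dispElement_mul_of_disjoint (hj j) (ih hL.2) (fun m => by
        by_cases hm : m.1 = j
        · right; rw [if_neg]; rw [hm]; exact hL.1
        · left; rw [if_neg hm]) l k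
      rw [List.map_cons, List.prod_cons, h]
      have e : ((fun m : S.Mode => if m.1 = j then α m.1 m.2 else 0) +
          fun m : S.Mode => if m.1 ∈ L then α m.1 m.2 else 0)
          = fun m : S.Mode => if m.1 ∈ j :: L then α m.1 m.2 else 0 := by
        ext m
        by_cases hm : m.1 = j
        · simp [hm, hL.1]
        · simp [hm]
      rw [e]
  have h := hL (List.finRange C) (List.nodup_finRange C) l k
  rw [displacement, List.ofFn_eq_map, h]
  simp

end ModeSystem

/-! ### The matrix elements as Schwartz functions -/

theorem one_add_pow_mul_exp_le (m : ℕ) {r : ℝ} (hr : 0 ≤ r) :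
    (1 + r) ^ m * Real.exp (-r ^ 2 / 2) ≤ m.factorial * Real.exp (3 / 2) := by
  have h1 : (1 + r) ^ m ≤ m.factorial * Real.exp (1 + r) := by
    have := Real.pow_div_factorial_le_exp (1 + r) (by positivity) m
    rwa [div_le_iff₀ (by positivity), mul_comm] at this
  have h2 : Real.exp (-r ^ 2 / 2) ≤ Real.exp (1 / 2 - r) :=
    Real.exp_le_exp.2 (by nlinarith [sq_nonneg (r - 1)])
  calc _ ≤ (m.factorial * Real.exp (1 + r)) * Real.exp (1 / 2 - r) := by gcongr
    _ = m.factorial * Real.exp (3 / 2) := by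
      rw [mul_assoc, ← Real.exp_add]; congr 2; ring

theorem norm_iteratedFDeriv_cexp_neg_half (i : ℕ) (t : ℝ) :
    ‖iteratedFDeriv ℝ i (fun t : ℝ => Complex.exp (-(t : ℂ) / 2)) t‖ ≤ Real.exp (-t / 2) := by
  have h : ∀ i, iteratedDeriv i (fun t : ℝ => Complex.exp (-(t : ℂ) / 2))
      = fun t : ℝ => (-1 / 2 : ℂ) ^ i * Complex.exp (-(t : ℂ) / 2) := by
    intro i
    induction i with
    | zero => simp
    | succ i ih =>
      rw [iteratedDeriv_succ, ih]
      ext t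
      have h1 : HasDerivAt (fun t : ℝ => -(t : ℂ) / 2) (-1 / 2) t :=
        (Complex.ofRealCLM.hasDerivAt (x := t)).neg.div_const 2
      rw [(h1.cexp.const_mul ((-1 / 2 : ℂ) ^ i)).deriv]
      ring
  rw [norm_iteratedFDeriv_eq_norm_iteratedDeriv, h, norm_mul, norm_pow, Complex.norm_exp]
  have e : (-(t : ℂ) / 2).re = -t / 2 := by
    rw [show -(t : ℂ) / 2 = ((-t / 2 : ℝ) : ℂ) by push_cast; ring, Complex.ofReal_re]
  rw [e]
  have : ‖(-1 / 2 : ℂ)‖ ^ i ≤ 1 := pow_le_one₀ (norm_nonneg _) (by norm_num)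
  exact mul_le_of_le_one_left (Real.exp_pos _).le this

/-- The Gaussian `exp (-‖x‖² / 2)` as a Schwartz function. -/
def gaussianSchwartz (E : Type*) [NormedAddCommGroup E] [InnerProductSpace ℝ E] : 𝓢(E, ℂ) where
  toFun := (fun t : ℝ => Complex.exp (-(t : ℂ) / 2)) ∘ fun x : E => ‖x‖ ^ 2
  smooth' := by
    have h : ContDiff ℝ ∞ fun t : ℝ => Complex.exp (-(t : ℂ) / 2) :=
      ((Complex.ofRealCLM.contDiff.neg).div_const 2).cexp
    exact h.comp (contDiff_norm_sq ℝ)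
  decay' := by
    intro k n
    have h : ContDiff ℝ ∞ fun t : ℝ => Complex.exp (-(t : ℂ) / 2) :=
      ((Complex.ofRealCLM.contDiff.neg).div_const 2).cexp
    obtain ⟨K, C, hC, hK⟩ :=
      (Function.hasTemperateGrowth_norm_sq (H := E)).norm_iteratedFDeriv_le_uniform n
    refine ⟨n.factorial * (C + 1) ^ n * ((k + K * n).factorial * Real.exp (3 / 2)), fun x => ?_⟩
    have h1 : (1 : ℝ) ≤ (1 + ‖x‖) ^ K := one_le_pow₀ (by linarith [norm_nonneg x])
    have h2 := norm_iteratedFDeriv_comp_le (N := ∞) (n := n) h (contDiff_norm_sq (E := E) ℝ)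
      (by exact_mod_cast le_top) x (C := Real.exp (-‖x‖ ^ 2 / 2)) (D := (C + 1) * (1 + ‖x‖) ^ K)
      (fun i _ => norm_iteratedFDeriv_cexp_neg_half i _) (fun i hi hin => by
        refine (hK i hin x).trans (le_trans ?_ (le_self_pow₀ ?_ (by omega)))
        · gcongr; linarith
        · nlinarith)
    have h3 : ‖x‖ ^ k ≤ (1 + ‖x‖) ^ k := by gcongr; linarith
    calc _ ≤ (1 + ‖x‖) ^ k * (n.factorial * Real.exp (-‖x‖ ^ 2 / 2) *
          ((C + 1) * (1 + ‖x‖) ^ K) ^ n) := by gcongr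
      _ = n.factorial * (C + 1) ^ n * ((1 + ‖x‖) ^ (k + K * n) * Real.exp (-‖x‖ ^ 2 / 2)) := by
        rw [mul_pow, ← pow_mul, pow_add]; ring
      _ ≤ _ := mul_le_mul_of_nonneg_left (one_add_pow_mul_exp_le _ (norm_nonneg x)) (by positivity)

theorem gaussianSchwartz_apply {E : Type*} [NormedAddCommGroup E] [InnerProductSpace ℝ E] (x : E) :
    gaussianSchwartz E x = Complex.exp (-((‖x‖ ^ 2 : ℝ) : ℂ) / 2) := rfl

theorem hasTemperateGrowth_complexHermite {E : Type*} [NormedAddCommGroup E] [NormedSpace ℝ E]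
    {z w : E → ℂ} (hz : z.HasTemperateGrowth) (hw : w.HasTemperateGrowth) (k l : ℕ) :
    (fun x => complexHermite k l (z x) (w x)).HasTemperateGrowth := by
  induction k generalizing l with
  | zero => exact hw.pow l
  | succ k ih =>
    exact (hz.mul (ih l)).add ((Function.HasTemperateGrowth.const (l : ℂ)).mul (ih (l - 1)))

theorem hasTemperateGrowth_prod {E ι : Type*} [NormedAddCommGroup E] [NormedSpace ℝ E]
    {f : ι → E → ℂ} (s : Finset ι) (hf : ∀ i, (f i).HasTemperateGrowth) :
    (fun x => ∏ i ∈ s, f i x).HasTemperateGrowth := by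
  classical
  induction s using Finset.induction_on with
  | empty => simp [Function.HasTemperateGrowth.const (1 : ℂ)]
  | insert i s hi ih =>
    simp only [Finset.prod_insert hi]
    exact (hf i).mul ih

section

variable {I : Type*} [Fintype I]

theorem hasTemperateGrowth_coord (m : I) :
    (fun v : EuclideanSpace ℂ I => v m).HasTemperateGrowth :=
  ((EuclideanSpace.proj m : EuclideanSpace ℂ I →L[ℂ] ℂ).restrictScalars ℝ).hasTemperateGrowth

theorem hasTemperateGrowth_conj_coord (m : I) :
    (fun v : EuclideanSpace ℂ I => conj (v m)).HasTemperateGrowth :=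
  ((Complex.conjCLE : ℂ →L[ℝ] ℂ).comp
    ((EuclideanSpace.proj m : EuclideanSpace ℂ I →L[ℂ] ℂ).restrictScalars ℝ)).hasTemperateGrowth

/-- The polynomial prefactor of `dispElement v (-conj v) k l`. -/
def dispPoly (k l : I → ℕ) (v : EuclideanSpace ℂ I) : ℂ :=
  ∏ m, complexHermite (k m) (l m) (v m) (-conj (v m)) *
    ((√((k m).factorial : ℝ) * √((l m).factorial : ℝ) : ℝ) : ℂ)⁻¹

theorem hasTemperateGrowth_dispPoly (k l : I → ℕ) : (dispPoly k l).HasTemperateGrowth :=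
  hasTemperateGrowth_prod _ fun m => (hasTemperateGrowth_complexHermite
    (hasTemperateGrowth_coord m) (hasTemperateGrowth_conj_coord m).neg _ _).mul
      (Function.HasTemperateGrowth.const _)

/-- The matrix element `λ ↦ ⟨k| D(λ) |l⟩` of the displacement operator as a Schwartz function of the
amplitudes. -/
def dispSchwartz (k l : I → ℕ) : 𝓢(EuclideanSpace ℂ I, ℂ) :=
  SchwartzMap.smulLeftCLM ℂ (dispPoly k l) (gaussianSchwartz (EuclideanSpace ℂ I))

theorem dispSchwartz_apply (k l : I → ℕ) (v : EuclideanSpace ℂ I) :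
    dispSchwartz k l v = dispElement v (fun m => -conj (v m)) k l := by
  rw [dispSchwartz, SchwartzMap.smulLeftCLM_apply_apply (hasTemperateGrowth_dispPoly k l),
    gaussianSchwartz_apply, dispPoly, dispElement, EuclideanSpace.norm_sq_eq, smul_eq_mul]
  have e : Complex.exp (-((∑ i, ‖v i‖ ^ 2 : ℝ) : ℂ) / 2)
      = ∏ m, Complex.exp (v m * -conj (v m) / 2) := by
    rw [← Complex.exp_sum]
    congr 1
    push_cast
    rw [← Finset.sum_neg_distrib, Finset.sum_div]
    refine Finset.sum_congr rfl fun m _ => ?_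
    rw [mul_neg, Complex.mul_conj']
  rw [e, ← Finset.prod_mul_distrib]
  refine Finset.prod_congr rfl fun m _ => ?_
  rw [modeElement]
  ring

/-! ### Ladder operators on Schwartz functions of the amplitudes -/

/-- Multiplication by the amplitude `λₘ`. -/
def mulCoord (m : I) : 𝓢(EuclideanSpace ℂ I, ℂ) →L[ℂ] 𝓢(EuclideanSpace ℂ I, ℂ) :=
  SchwartzMap.smulLeftCLM ℂ fun v => v m

/-- Multiplication by the conjugate amplitude `λₘ*`. -/
def mulConjCoord (m : I) : 𝓢(EuclideanSpace ℂ I, ℂ) →L[ℂ] 𝓢(EuclideanSpace ℂ I, ℂ) :=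
  SchwartzMap.smulLeftCLM ℂ fun v => conj (v m)

theorem mulCoord_apply (m : I) (f : 𝓢(EuclideanSpace ℂ I, ℂ)) (v : EuclideanSpace ℂ I) :
    mulCoord m f v = v m * f v :=
  SchwartzMap.smulLeftCLM_apply_apply (hasTemperateGrowth_coord m) f v

theorem mulConjCoord_apply (m : I) (f : 𝓢(EuclideanSpace ℂ I, ℂ)) (v : EuclideanSpace ℂ I) :
    mulConjCoord m f v = conj (v m) * f v :=
  SchwartzMap.smulLeftCLM_apply_apply (hasTemperateGrowth_conj_coord m) f v

variable [DecidableEq I]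

/-- The Wirtinger derivative `∂/∂λₘ`. -/
def wirt (m : I) (f : 𝓢(EuclideanSpace ℂ I, ℂ)) : 𝓢(EuclideanSpace ℂ I, ℂ) :=
  (1 / 2 : ℂ) • (∂_{EuclideanSpace.single m (1 : ℂ)} f
    - Complex.I • ∂_{EuclideanSpace.single m Complex.I} f)

/-- The Wirtinger derivative `∂/∂λₘ*`. -/
def wirtConj (m : I) (f : 𝓢(EuclideanSpace ℂ I, ℂ)) : 𝓢(EuclideanSpace ℂ I, ℂ) :=
  (1 / 2 : ℂ) • (∂_{EuclideanSpace.single m (1 : ℂ)} f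
    + Complex.I • ∂_{EuclideanSpace.single m Complex.I} f)

theorem wirt_apply (m : I) (f : 𝓢(EuclideanSpace ℂ I, ℂ)) (v : EuclideanSpace ℂ I) :
    wirt m f v = (lineDeriv ℝ f v (EuclideanSpace.single m (1 : ℂ))
      - Complex.I * lineDeriv ℝ f v (EuclideanSpace.single m Complex.I)) / 2 := by
  simp only [wirt, smul_apply, sub_apply, SchwartzMap.lineDerivOp_apply,
    smul_eq_mul]
  ring

theorem wirtConj_apply (m : I) (f : 𝓢(EuclideanSpace ℂ I, ℂ)) (v : EuclideanSpace ℂ I) :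
    wirtConj m f v = (lineDeriv ℝ f v (EuclideanSpace.single m (1 : ℂ))
      + Complex.I * lineDeriv ℝ f v (EuclideanSpace.single m Complex.I)) / 2 := by
  simp only [wirtConj, smul_apply, add_apply,
    SchwartzMap.lineDerivOp_apply, smul_eq_mul]
  ring

theorem lineDeriv_dispSchwartz (k l : I → ℕ) (v : EuclideanSpace ℂ I) (m : I) (ζ : ℂ) :
    lineDeriv ℝ (dispSchwartz k l) v (EuclideanSpace.single m ζ)
      = ζ * ((√(k m : ℝ) : ℂ) * dispSchwartz (k - Pi.single m 1) l v
          - conj (v m) / 2 * dispSchwartz k l v)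
        - conj ζ * ((√(l m : ℝ) : ℂ) * dispSchwartz k (l - Pi.single m 1) v
          + v m / 2 * dispSchwartz k l v) := by
  have hz : ∀ i, HasDerivAt (fun s : ℝ => (v + s • EuclideanSpace.single m ζ) i)
      ((Pi.single m ζ : I → ℂ) i) 0 := by
    intro i
    have h := ((Complex.ofRealCLM.hasDerivAt (x := 0)).mul_const
      ((Pi.single m ζ : I → ℂ) i)).const_add (v i)
    simpa [Pi.single_apply] using h
  have hw : ∀ i, HasDerivAt (fun s : ℝ => -conj ((v + s • EuclideanSpace.single m ζ) i))
      (-conj ((Pi.single m ζ : I → ℂ) i)) 0 := fun i =>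
    ((Complex.conjCLE : ℂ →L[ℝ] ℂ).hasFDerivAt.comp_hasDerivAt 0 (hz i)).neg
  have h := hasDerivAt_dispElement (𝕜 := ℝ)
    (z := fun s : ℝ => (v + s • EuclideanSpace.single m ζ : EuclideanSpace ℂ I))
    (w := fun s i => -conj ((v + s • EuclideanSpace.single m ζ : EuclideanSpace ℂ I) i)) hz hw k l
  have e : (fun s : ℝ => dispSchwartz k l (v + s • EuclideanSpace.single m ζ))
      = fun s : ℝ => dispElement (v + s • EuclideanSpace.single m ζ : EuclideanSpace ℂ I)
        (fun i => -conj ((v + s • EuclideanSpace.single m ζ : EuclideanSpace ℂ I) i)) k l := by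
    ext s; rw [dispSchwartz_apply]
  rw [lineDeriv, e, h.deriv, Finset.sum_eq_single m]
  · simp only [Pi.single_eq_same, zero_smul, add_zero, dispSchwartz_apply]
    ring
  · intro i _ hi
    simp [hi]
  · simp

theorem wirt_dispSchwartz (k l : I → ℕ) (m : I) :
    wirt m (dispSchwartz k l) = (√(k m : ℝ) : ℂ) • dispSchwartz (k - Pi.single m 1) l
      - (1 / 2 : ℂ) • mulConjCoord m (dispSchwartz k l) := by
  ext v
  rw [wirt_apply, lineDeriv_dispSchwartz, lineDeriv_dispSchwartz]
  simp only [smul_apply, sub_apply, mulConjCoord_apply, smul_eq_mul,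
    map_one, Complex.conj_I]
  linear_combination (norm := ring_nf) ((-1 / 2 : ℂ) *
    ((√(k m : ℝ) : ℂ) * dispSchwartz (k - Pi.single m 1) l v
          - conj (v m) / 2 * dispSchwartz k l v) - 1 / 2 *
    ((√(l m : ℝ) : ℂ) * dispSchwartz k (l - Pi.single m 1) v
          + v m / 2 * dispSchwartz k l v)) * Complex.I_sq

theorem wirtConj_dispSchwartz (k l : I → ℕ) (m : I) :
    wirtConj m (dispSchwartz k l) = -(√(l m : ℝ) : ℂ) • dispSchwartz k (l - Pi.single m 1)
      - (1 / 2 : ℂ) • mulCoord m (dispSchwartz k l) := by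
  ext v
  rw [wirtConj_apply, lineDeriv_dispSchwartz, lineDeriv_dispSchwartz]
  simp only [smul_apply, sub_apply, mulCoord_apply, smul_eq_mul,
    map_one, Complex.conj_I]
  linear_combination (norm := ring_nf) ((1 / 2 : ℂ) *
    ((√(k m : ℝ) : ℂ) * dispSchwartz (k - Pi.single m 1) l v
          - conj (v m) / 2 * dispSchwartz k l v) + 1 / 2 *
    ((√(l m : ℝ) : ℂ) * dispSchwartz k (l - Pi.single m 1) v
          + v m / 2 * dispSchwartz k l v)) * Complex.I_sq

theorem mulCoord_dispSchwartz (k l : I → ℕ) (m : I) :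
    mulCoord m (dispSchwartz k l) = (√(k m + 1 : ℝ) : ℂ) • dispSchwartz (k + Pi.single m 1) l
      - (√(l m : ℝ) : ℂ) • dispSchwartz k (l - Pi.single m 1) := by
  ext v
  have := dispElement_add_left (⇑v) (fun m => -conj (v m)) k l m
  simp only [smul_apply, sub_apply, mulCoord_apply, smul_eq_mul,
    dispSchwartz_apply]
  rw [this]; ring

theorem mulConjCoord_dispSchwartz (k l : I → ℕ) (m : I) :
    mulConjCoord m (dispSchwartz k l) = (√(k m : ℝ) : ℂ) • dispSchwartz (k - Pi.single m 1) l
      - (√(l m + 1 : ℝ) : ℂ) • dispSchwartz k (l + Pi.single m 1) := by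
  ext v
  have := dispElement_add_right (⇑v) (fun m => -conj (v m)) k l m
  simp only [smul_apply, sub_apply, mulConjCoord_apply, smul_eq_mul,
    dispSchwartz_apply]
  rw [this]; ring

end

/-! ### Orthogonality of the matrix elements -/

section

variable {I : Type*} [Fintype I]

/-- The bilinear pairing `∫ f g` of Schwartz functions. -/
def pairing (f g : 𝓢(EuclideanSpace ℂ I, ℂ)) : ℂ := ∫ v, f v * g v

theorem integrable_mul_schwartz (f g : 𝓢(EuclideanSpace ℂ I, ℂ)) :
    Integrable fun v => f v * g v :=
  (f.memLp 2).integrable_mul (g.memLp 2)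

theorem pairing_add_left (f₁ f₂ g : 𝓢(EuclideanSpace ℂ I, ℂ)) :
    pairing (f₁ + f₂) g = pairing f₁ g + pairing f₂ g := by
  simp only [pairing, add_apply, add_mul]
  exact integral_add (integrable_mul_schwartz f₁ g) (integrable_mul_schwartz f₂ g)

theorem pairing_smul_left (c : ℂ) (f g : 𝓢(EuclideanSpace ℂ I, ℂ)) :
    pairing (c • f) g = c * pairing f g := by
  simp only [pairing, smul_apply, smul_eq_mul, mul_assoc]
  exact integral_const_mul _ _

theorem pairing_comm (f g : 𝓢(EuclideanSpace ℂ I, ℂ)) : pairing f g = pairing g f := by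
  simp only [pairing, mul_comm]

theorem pairing_sub_left (f₁ f₂ g : 𝓢(EuclideanSpace ℂ I, ℂ)) :
    pairing (f₁ - f₂) g = pairing f₁ g - pairing f₂ g := by
  rw [sub_eq_add_neg, pairing_add_left, ← neg_one_smul ℂ f₂, pairing_smul_left]; ring

theorem pairing_add_right (f g₁ g₂ : 𝓢(EuclideanSpace ℂ I, ℂ)) :
    pairing f (g₁ + g₂) = pairing f g₁ + pairing f g₂ := by
  rw [pairing_comm, pairing_add_left, pairing_comm g₁, pairing_comm g₂]

theorem pairing_sub_right (f g₁ g₂ : 𝓢(EuclideanSpace ℂ I, ℂ)) :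
    pairing f (g₁ - g₂) = pairing f g₁ - pairing f g₂ := by
  rw [pairing_comm, pairing_sub_left, pairing_comm g₁, pairing_comm g₂]

theorem pairing_smul_right (c : ℂ) (f g : 𝓢(EuclideanSpace ℂ I, ℂ)) :
    pairing f (c • g) = c * pairing f g := by
  rw [pairing_comm, pairing_smul_left, pairing_comm g]

theorem pairing_mulCoord (m : I) (f g : 𝓢(EuclideanSpace ℂ I, ℂ)) :
    pairing (mulCoord m f) g = pairing f (mulCoord m g) := by
  simp only [pairing, mulCoord_apply]
  exact integral_congr_ae (Eventually.of_forall fun v => by ring)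

theorem pairing_mulConjCoord (m : I) (f g : 𝓢(EuclideanSpace ℂ I, ℂ)) :
    pairing (mulConjCoord m f) g = pairing f (mulConjCoord m g) := by
  simp only [pairing, mulConjCoord_apply]
  exact integral_congr_ae (Eventually.of_forall fun v => by ring)

theorem pairing_lineDeriv (u : EuclideanSpace ℂ I) (f g : 𝓢(EuclideanSpace ℂ I, ℂ)) :
    pairing (∂_{u} f) g = -pairing f (∂_{u} g) := by
  rw [pairing, pairing, SchwartzMap.integral_mul_lineDerivOp_right_eq_neg_left, neg_neg]

variable [DecidableEq I]

theorem pairing_wirt (m : I) (f g : 𝓢(EuclideanSpace ℂ I, ℂ)) :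
    pairing (wirt m f) g = -pairing f (wirt m g) := by
  simp only [wirt, pairing_smul_left, pairing_smul_right, pairing_sub_left, pairing_sub_right,
    pairing_lineDeriv]
  ring

theorem pairing_wirtConj (m : I) (f g : 𝓢(EuclideanSpace ℂ I, ℂ)) :
    pairing (wirtConj m f) g = -pairing f (wirtConj m g) := by
  simp only [wirtConj, pairing_smul_left, pairing_smul_right, pairing_add_left, pairing_add_right,
    pairing_lineDeriv]
  ring

/-! The next four identities move a ladder operator from a matrix element to the other factor of the
pairing. They encode `a† D(λ) = (∂ + λ*/2) D(λ)`, `a D(λ) = (λ/2 - ∂*) D(λ)`,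
`D(λ) a = -(∂* + λ/2) D(λ)` and `D(λ) a† = (∂ - λ*/2) D(λ)`, where `∂`, `∂*` are the Wirtinger
derivatives. -/

theorem pairing_sub_single_left (k l : I → ℕ) (m : I) (g : 𝓢(EuclideanSpace ℂ I, ℂ)) :
    (√(k m : ℝ) : ℂ) * pairing (dispSchwartz (k - Pi.single m 1) l) g
      = pairing (dispSchwartz k l) ((1 / 2 : ℂ) • mulConjCoord m g - wirt m g) := by
  have h := congrArg (pairing · g) (wirt_dispSchwartz k l m)
  simp only [pairing_wirt, pairing_sub_left, pairing_smul_left, pairing_mulConjCoord] at h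
  rw [pairing_sub_right, pairing_smul_right]
  linear_combination -h

theorem pairing_sub_single_right (k l : I → ℕ) (m : I) (g : 𝓢(EuclideanSpace ℂ I, ℂ)) :
    (√(l m : ℝ) : ℂ) * pairing (dispSchwartz k (l - Pi.single m 1)) g
      = pairing (dispSchwartz k l) (wirtConj m g - (1 / 2 : ℂ) • mulCoord m g) := by
  have h := congrArg (pairing · g) (wirtConj_dispSchwartz k l m)
  simp only [pairing_wirtConj, pairing_sub_left, pairing_smul_left, pairing_mulCoord] at h
  rw [pairing_sub_right, pairing_smul_right]
  linear_combination h

theorem pairing_add_single_left (k l : I → ℕ) (m : I) (g : 𝓢(EuclideanSpace ℂ I, ℂ)) :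
    (√(k m + 1 : ℝ) : ℂ) * pairing (dispSchwartz (k + Pi.single m 1) l) g
      = pairing (dispSchwartz k l) (wirtConj m g + (1 / 2 : ℂ) • mulCoord m g) := by
  have h := congrArg (pairing · g) (mulCoord_dispSchwartz k l m)
  simp only [pairing_sub_left, pairing_smul_left, pairing_mulCoord] at h
  have h2 := pairing_sub_single_right k l m g
  rw [pairing_sub_right, pairing_smul_right] at h2
  rw [pairing_add_right, pairing_smul_right]
  linear_combination h2 - h

theorem pairing_add_single_right (k l : I → ℕ) (m : I) (g : 𝓢(EuclideanSpace ℂ I, ℂ)) :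
    (√(l m + 1 : ℝ) : ℂ) * pairing (dispSchwartz k (l + Pi.single m 1)) g
      = pairing (dispSchwartz k l) (-wirt m g - (1 / 2 : ℂ) • mulConjCoord m g) := by
  have h := congrArg (pairing · g) (mulConjCoord_dispSchwartz k l m)
  simp only [pairing_sub_left, pairing_smul_left, pairing_mulConjCoord] at h
  have h2 := pairing_sub_single_left k l m g
  rw [pairing_sub_right, pairing_smul_right] at h2
  rw [pairing_sub_right, pairing_smul_right, ← neg_one_smul ℂ (wirt m g), pairing_smul_right]
  linear_combination h2 + h

theorem pairing_disp_add_left (k l k' l' : I → ℕ) (m : I) :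
    (√(k m + 1 : ℝ) : ℂ) * pairing (dispSchwartz (k + Pi.single m 1) l) (dispSchwartz k' l')
      = -((√(l' m : ℝ) : ℂ) *
        pairing (dispSchwartz k l) (dispSchwartz k' (l' - Pi.single m 1))) := by
  rw [pairing_add_single_left, wirtConj_dispSchwartz, sub_add_cancel, pairing_smul_right]
  ring

theorem pairing_disp_sub_left (k l k' l' : I → ℕ) (m : I) :
    (√(k m : ℝ) : ℂ) * pairing (dispSchwartz (k - Pi.single m 1) l) (dispSchwartz k' l')
      = -((√(l' m + 1 : ℝ) : ℂ) *
        pairing (dispSchwartz k l) (dispSchwartz k' (l' + Pi.single m 1))) := by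
  rw [pairing_sub_single_left, wirt_dispSchwartz, mulConjCoord_dispSchwartz, pairing_sub_right,
    pairing_sub_right, pairing_smul_right, pairing_smul_right, pairing_sub_right,
    pairing_smul_right, pairing_smul_right]
  ring

theorem pairing_disp_both (k l k' l' : I → ℕ) (m : I) :
    (√(k m + 1 : ℝ) : ℂ) * pairing (dispSchwartz k l) (dispSchwartz k' l')
      = -((√(l' m + 1 : ℝ) : ℂ) *
        pairing (dispSchwartz (k + Pi.single m 1) l) (dispSchwartz k' (l' + Pi.single m 1))) := by
  have h := pairing_disp_sub_left (k + Pi.single m 1) l k' l' m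
  have e : k + Pi.single m 1 - Pi.single m 1 = k := by ext i; simp
  rw [e] at h
  simpa using h

theorem pairing_disp_eq_zero_of_ne (k l k' l' : I → ℕ) (h : k ≠ l') :
    pairing (dispSchwartz k l) (dispSchwartz k' l') = 0 := by
  obtain ⟨m, hm⟩ := Function.ne_iff.1 h
  have h1 := pairing_disp_both k l k' l' m
  have h2 := pairing_disp_add_left k l k' (l' + Pi.single m 1) m
  simp only [Pi.add_apply, Pi.single_eq_same, add_tsub_cancel_right, Nat.cast_add,
    Nat.cast_one] at h2
  have h3 : ((k m : ℂ) - l' m) * pairing (dispSchwartz k l) (dispSchwartz k' l') = 0 := by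
    have e1 := sqrt_succ_mul_self_complex (k m)
    have e2 := sqrt_succ_mul_self_complex (l' m)
    linear_combination (√(k m + 1 : ℝ) : ℂ) * h1 - (√(l' m + 1 : ℝ) : ℂ) * h2
      - pairing (dispSchwartz k l) (dispSchwartz k' l') * (e1 - e2)
  refine (mul_eq_zero.1 h3).resolve_left fun h0 => hm ?_
  exact_mod_cast sub_eq_zero.1 h0

theorem pairing_disp_add_add (k l k' : I → ℕ) (m : I) :
    pairing (dispSchwartz (k + Pi.single m 1) l) (dispSchwartz k' (k + Pi.single m 1))
      = -pairing (dispSchwartz k l) (dispSchwartz k' k) := by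
  have h1 := pairing_disp_both k l k' k m
  have := sqrt_succ_ne_zero (k m)
  refine mul_left_cancel₀ this ?_
  linear_combination h1

theorem multiindex_induction {I : Type*} [Fintype I] [DecidableEq I] {P : (I → ℕ) → Prop}
    (h0 : P 0) (h : ∀ k m, P k → P (k + Pi.single m 1)) (k : I → ℕ) : P k := by
  induction hn : ∑ m, k m generalizing k with
  | zero =>
    rw [Finset.sum_eq_zero_iff] at hn
    have : k = 0 := funext fun m => hn m (Finset.mem_univ m)
    rwa [this]
  | succ n ih =>
    obtain ⟨m, -, hm⟩ := Finset.exists_ne_zero_of_sum_ne_zero (hn.trans_ne n.succ_ne_zero)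
    have e : (k - Pi.single m 1) + Pi.single m 1 = k := (shift_iff _ _ m).2 ⟨hm, rfl⟩
    rw [← e]
    refine h _ m (ih _ ?_)
    rw [← e] at hn
    simp only [Pi.add_apply, Finset.sum_add_distrib, Finset.sum_pi_single', Finset.mem_univ,
      if_true] at hn
    omega

theorem pairing_disp_swap (k l : I → ℕ) :
    pairing (dispSchwartz k l) (dispSchwartz l k)
      = (-1) ^ (∑ m, k m + ∑ m, l m) * pairing (dispSchwartz (0 : I → ℕ) 0) (dispSchwartz 0 0) := by
  have hs : ∀ (k : I → ℕ) m, ∑ i, (k + Pi.single m 1 : I → ℕ) i = ∑ i, k i + 1 := by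
    intro k m
    simp [Finset.sum_add_distrib]
  induction k using multiindex_induction with
  | h0 =>
    induction l using multiindex_induction with
    | h0 => simp
    | h l m ih =>
      rw [pairing_comm, pairing_disp_add_add, pairing_comm, ih, hs]
      ring
  | h k m ih => rw [pairing_disp_add_add, ih, hs]; ring

omit [DecidableEq I] in
theorem conj_dispSchwartz (k l : I → ℕ) (v : EuclideanSpace ℂ I) :
    conj (dispSchwartz k l v) = (-1) ^ (∑ m, k m + ∑ m, l m) * dispSchwartz l k v := by
  rw [dispSchwartz_apply, dispSchwartz_apply, conj_dispElement]

theorem inner_dispSchwartz (p q : (I → ℕ) × (I → ℕ)) :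
    inner ℂ ((dispSchwartz p.1 p.2).toLp 2) ((dispSchwartz q.1 q.2).toLp 2)
      = if p = q then pairing (dispSchwartz (0 : I → ℕ) 0) (dispSchwartz 0 0) else 0 := by
  obtain ⟨k, l⟩ := p
  obtain ⟨k', l'⟩ := q
  refine (SchwartzMap.inner_toL2_toL2_eq (dispSchwartz k l) (dispSchwartz k' l') volume).trans ?_
  have e : ∫ v, inner ℂ (dispSchwartz k l v) (dispSchwartz k' l' v)
      = (-1) ^ (∑ m, k m + ∑ m, l m) * pairing (dispSchwartz l k) (dispSchwartz k' l') := by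
    rw [pairing, ← integral_const_mul]
    refine integral_congr_ae (Eventually.of_forall fun v => ?_)
    simp only [RCLike.inner_apply, conj_dispSchwartz]
    ring
  simp only [e, Prod.mk.injEq]
  split_ifs with h
  · obtain ⟨rfl, rfl⟩ := h
    rw [pairing_disp_swap, ← mul_assoc, ← pow_add]
    rw [Even.neg_one_pow ⟨∑ m, k m + ∑ m, l m, by ring⟩, one_mul]
  · by_cases hl : l = l'
    · have hk : k' ≠ k := fun hk => h ⟨hk.symm, hl⟩
      rw [pairing_comm, pairing_disp_eq_zero_of_ne _ _ _ _ hk, mul_zero]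
    · rw [pairing_disp_eq_zero_of_ne _ _ _ _ hl, mul_zero]

/-- The square root of the common squared norm of all matrix elements. -/
def dispNorm (I : Type*) [Fintype I] : ℝ := ‖(dispSchwartz (0 : I → ℕ) 0).toLp 2‖

omit [DecidableEq I] in
theorem dispNorm_ne_zero : dispNorm I ≠ 0 := by
  intro h
  have h1 : (dispSchwartz (0 : I → ℕ) 0).toLp 2 = (0 : 𝓢(EuclideanSpace ℂ I, ℂ)).toLp 2 := by
    rw [dispNorm, norm_eq_zero] at h
    rw [h]
    exact (map_zero (SchwartzMap.toLpCLM ℂ (E := EuclideanSpace ℂ I) ℂ 2 volume)).symm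
  have h2 := SchwartzMap.injective_toLp 2 volume h1
  have h3 := congrArg (fun f : 𝓢(EuclideanSpace ℂ I, ℂ) => f 0) h2
  simp [dispSchwartz_apply, dispElement, modeElement, complexHermite] at h3

/-- The matrix element `⟨k| D(λ) |l⟩`, `p = (k, l)`, as an element of `L²`. -/
def dispL2 (p : (I → ℕ) × (I → ℕ)) : Lp (α := EuclideanSpace ℂ I) ℂ 2 :=
  (dispSchwartz p.1 p.2).toLp 2

theorem orthonormal_dispL2 :
    Orthonormal ℂ fun p : (I → ℕ) × (I → ℕ) => ((dispNorm I : ℂ))⁻¹ • dispL2 p := by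
  have h0 : pairing (dispSchwartz (0 : I → ℕ) 0) (dispSchwartz 0 0) = (dispNorm I : ℂ) ^ 2 := by
    have := inner_dispSchwartz ((0, 0) : (I → ℕ) × (I → ℕ)) (0, 0)
    rw [if_pos rfl, inner_self_eq_norm_sq_to_K] at this
    exact this.symm
  rw [orthonormal_iff_ite]
  intro p q
  have hr : (dispNorm I : ℂ) ≠ 0 := by exact_mod_cast dispNorm_ne_zero
  rw [inner_smul_left, inner_smul_right, dispL2, dispL2, inner_dispSchwartz, h0, map_inv₀,
    Complex.conj_ofReal]
  split_ifs
  · field_simp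
  · simp

theorem summable_smul_dispL2 {a : (I → ℕ) × (I → ℕ) → ℂ} (ha : Summable fun p => ‖a p‖ ^ 2) :
    Summable fun p => a p • dispL2 p := by
  have hr : (dispNorm I : ℂ) ≠ 0 := by exact_mod_cast dispNorm_ne_zero
  have h := (orthonormal_dispL2 (I := I)).orthogonalFamily.summable_iff_norm_sq_summable a
  have h2 := (h.2 ha).const_smul (dispNorm I : ℂ)
  refine h2.congr fun p => ?_
  simp only [LinearIsometry.toSpanSingleton_apply]
  rw [smul_comm, smul_smul (dispNorm I : ℂ), mul_inv_cancel₀ hr, one_smul]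

end

/-! ### Mean-square limits -/

theorem ae_eq_of_tendsto_eLpNorm_sub {X ι : Type*} [MeasurableSpace X] {μ : Measure X}
    {F : ι → X → ℂ} {l : Filter ι} [l.NeBot] {g h : X → ℂ}
    (hF : ∀ i, AEStronglyMeasurable (F i) μ) (hg : AEStronglyMeasurable g μ)
    (hh : AEStronglyMeasurable h μ)
    (h1 : Tendsto (fun i => eLpNorm (fun x => F i x - g x) 2 μ) l (𝓝 0))
    (h2 : Tendsto (fun i => eLpNorm (fun x => F i x - h x) 2 μ) l (𝓝 0)) : g =ᵐ[μ] h := by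
  have h0 : eLpNorm (g - h) 2 μ = 0 := by
    refine le_antisymm (ge_of_tendsto' (by simpa using h2.add h1) fun i => ?_) bot_le
    have e : g - h = (fun x => F i x - h x) - fun x => F i x - g x := by ext x; simp
    rw [e]
    exact eLpNorm_sub_le ((hF i).sub hh) ((hF i).sub hg) (by norm_num)
  rw [eLpNorm_eq_zero_iff (hg.sub hh) (by norm_num)] at h0
  filter_upwards [h0] with x hx
  exact sub_eq_zero.1 hx

theorem tendsto_eLpNorm_indicator_sub {X ι : Type*} [MeasurableSpace X] {μ : Measure X}
    {l : Filter ι} [l.IsCountablyGenerated] {s : ι → Set X} (hs : ∀ i, MeasurableSet (s i))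
    (hx : ∀ x, ∀ᶠ i in l, x ∈ s i) {f : X → ℂ} (hf : MemLp f 2 μ) :
    Tendsto (fun i => eLpNorm (fun x => (s i).indicator f x - f x) 2 μ) l (𝓝 0) := by
  have e : ∀ i, eLpNorm (fun x => (s i).indicator f x - f x) 2 μ
      = (∫⁻ x, ‖(s i).indicator f x - f x‖ₑ ^ (2 : ℝ) ∂μ) ^ (1 / 2 : ℝ) := by
    intro i
    rw [eLpNorm_eq_lintegral_rpow_enorm_toReal (by norm_num) (by norm_num)]
    simp
  simp only [e]
  have h := tendsto_lintegral_filter_of_dominated_convergence' (μ := μ) (l := l)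
    (F := fun i x => ‖(s i).indicator f x - f x‖ₑ ^ (2 : ℝ)) (f := fun _ => 0)
    (fun x => ‖f x‖ₑ ^ (2 : ℝ))
    (Eventually.of_forall fun i =>
      ((hf.1.indicator (hs i)).sub hf.1).enorm.pow_const _)
    (Eventually.of_forall fun i => Eventually.of_forall fun x => by
      refine ENNReal.rpow_le_rpow ?_ (by norm_num)
      by_cases hxs : x ∈ s i <;> simp [hxs])
    (by
      have := lintegral_rpow_enorm_lt_top_of_eLpNorm_lt_top (by norm_num) (by norm_num) hf.2
      simpa using this.ne)
    (Eventually.of_forall fun x => by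
      refine tendsto_const_nhds.congr' ?_
      filter_upwards [hx x] with i hi
      simp [hi])
  have h2 := h.ennrpow_const (1 / 2 : ℝ)
  simpa using h2

/-! ### The Fourier transform on `L²` -/

section Fourier

variable {E : Type*} [NormedAddCommGroup E] [InnerProductSpace ℝ E] [FiniteDimensional ℝ E]
  [MeasurableSpace E] [BorelSpace E]

theorem integral_fourier_L2_mul (X : Lp (α := E) ℂ 2) (g : 𝓢(E, ℂ)) :
    ∫ v, (𝓕 X : Lp (α := E) ℂ 2) v * g v = ∫ v, X v * 𝓕 g v := by
  have h := congrArg (fun T : 𝓢'(E, ℂ) => T g) (Lp.fourier_toTemperedDistribution_eq X)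
  simp only [TemperedDistribution.fourier_apply, Lp.toTemperedDistribution_apply,
    smul_eq_mul] at h
  simpa only [mul_comm] using h.symm

theorem integral_fourier_L1_mul {f : E → ℂ} (hf : Integrable f) (g : 𝓢(E, ℂ)) :
    ∫ v, 𝓕 f v * g v = ∫ v, f v * 𝓕 g v := by
  have := VectorFourier.integral_bilin_fourierIntegral_eq_flip (ContinuousLinearMap.mul ℂ ℂ)
    (L := innerₗ E) (μ := volume) (ν := volume) Real.continuous_fourierChar continuous_inner hf
    g.integrable
  simpa using! this

theorem continuous_fourier_of_integrable {f : E → ℂ} (hf : Integrable f) : Continuous (𝓕 f) :=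
  VectorFourier.fourierIntegral_continuous Real.continuous_fourierChar (L := innerₗ E)
    continuous_inner hf

/-- On `L¹ ∩ L²` the `L²` Fourier transform is given by the Fourier integral. -/
theorem coeFn_fourier_toLp {f : E → ℂ} (h1 : Integrable f) (h2 : MemLp f 2) :
    ((𝓕 h2.toLp : Lp (α := E) ℂ 2) : E → ℂ) =ᵐ[volume] 𝓕 f := by
  refine ae_eq_of_integral_contDiff_smul_eq
    ((Lp.memLp _).locallyIntegrable (by norm_num))
    (continuous_fourier_of_integrable h1).locallyIntegrable fun g hg hgc => ?_
  have hg' : ContDiff ℝ ∞ fun v => (g v : ℂ) := Complex.ofRealCLM.contDiff.comp hg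
  have hgc' : HasCompactSupport fun v => (g v : ℂ) := hgc.comp_left Complex.ofReal_zero
  have e1 := integral_fourier_L2_mul h2.toLp (hgc'.toSchwartzMap hg')
  have e2 := integral_fourier_L1_mul h1 (hgc'.toSchwartzMap hg')
  have e3 : ∫ v, (h2.toLp : E → ℂ) v * 𝓕 (hgc'.toSchwartzMap hg') v
      = ∫ v, f v * 𝓕 (hgc'.toSchwartzMap hg') v :=
    integral_congr_ae (by filter_upwards [h2.coeFn_toLp] with v hv; rw [hv])
  rw [e3, ← e2] at e1
  simpa [mul_comm] using! e1

/-- The Fourier integrals of cut-offs of a square-integrable function converge in mean square to its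
`L²` Fourier transform. -/
theorem tendsto_eLpNorm_fourier_indicator_sub {f : E → ℂ} (hf : MemLp f 2) {s : ℝ → Set E}
    (hs : ∀ R, MeasurableSet (s R)) (hx : ∀ x, ∀ᶠ R in atTop, x ∈ s R)
    (hb : ∀ R, volume (s R) ≠ ⊤) :
    Tendsto (fun R => eLpNorm (fun v => 𝓕 ((s R).indicator f) v
      - (𝓕 hf.toLp : Lp (α := E) ℂ 2) v) 2 volume) atTop (𝓝 0) := by
  refine (tendsto_eLpNorm_indicator_sub hs hx hf).congr fun R => ?_
  have hR : MemLp ((s R).indicator f) 2 volume := hf.indicator (hs R)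
  have hR1 : Integrable ((s R).indicator f) volume := by
    rw [integrable_indicator_iff (hs R)]
    have : IsFiniteMeasure (volume.restrict (s R)) := ⟨by
      rw [Measure.restrict_apply_univ]; exact (hb R).lt_top⟩
    exact (hf.restrict (s R)).integrable (by norm_num)
  have e1 : edist (𝓕 hR.toLp : Lp ℂ 2 (volume : Measure E)) (𝓕 hf.toLp)
      = edist hR.toLp hf.toLp :=
    (Lp.fourierTransformₗᵢ E ℂ).isometry.edist_eq _ _
  rw [Lp.edist_toLp_toLp, Lp.edist_def] at e1
  refine Eq.trans e1.symm (eLpNorm_congr_ae ?_)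
  filter_upwards [coeFn_fourier_toLp hR1 hR] with v hv
  rw [Pi.sub_apply, hv]

end Fourier

/-! ### Linear changes of variables -/

section LinearEquiv

variable {E F : Type*} [NormedAddCommGroup E] [NormedSpace ℝ E] [MeasureSpace E]
  [BorelSpace E] [Measure.IsAddHaarMeasure (volume : Measure E)]
  [NormedAddCommGroup F] [NormedSpace ℝ F] [FiniteDimensional ℝ F]
  [MeasureSpace F] [BorelSpace F] [Measure.IsAddHaarMeasure (volume : Measure F)]

theorem exists_map_volume_eq_smul (L : E ≃L[ℝ] F) :
    ∃ c : NNReal, Measure.map L volume = c • (volume : Measure F) := by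
  have h : (Measure.map L (volume : Measure E)).IsAddHaarMeasure := L.isAddHaarMeasure_map volume
  exact ⟨_, Measure.isAddLeftInvariant_eq_smul _ _⟩

/-- The factor by which the linear isomorphism `L` scales integrals. -/
def volumeFactor (L : E ≃L[ℝ] F) : NNReal := (exists_map_volume_eq_smul L).choose

theorem map_volume (L : E ≃L[ℝ] F) :
    Measure.map L volume = volumeFactor L • (volume : Measure F) :=
  (exists_map_volume_eq_smul L).choose_spec

theorem integral_comp_equiv (L : E ≃L[ℝ] F) (f : F → ℂ) :
    ∫ x, f (L x) = (volumeFactor L : ℂ) * ∫ y, f y := by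
  have hL : MeasurableEmbedding L := L.toHomeomorph.measurableEmbedding
  rw [← hL.integral_map f, map_volume, integral_smul_nnreal_measure]
  simp [NNReal.smul_def]

theorem quasiMeasurePreserving_equiv (L : E ≃L[ℝ] F) :
    Measure.QuasiMeasurePreserving L volume volume :=
  ⟨L.continuous.measurable, by rw [map_volume]; exact Measure.smul_absolutelyContinuous⟩

theorem eLpNorm_comp_equiv (L : E ≃L[ℝ] F) (f : F → ℂ) :
    eLpNorm (fun x => f (L x)) 2 volume
      = (volumeFactor L : ℝ≥0∞) ^ (1 / 2 : ℝ) * eLpNorm f 2 volume := by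
  have hL : MeasurableEmbedding L := L.toHomeomorph.measurableEmbedding
  have h := hL.eLpNorm_map_measure (p := 2) (g := f) (μ := volume)
  rw [map_volume] at h
  rw [show (fun x => f (L x)) = f ∘ L from rfl, ← h,
    eLpNorm_smul_measure_of_ne_top' (by norm_num), ENNReal.smul_def, smul_eq_mul,
    ENNReal.coe_rpow_of_nonneg _ (by positivity)]
  simp

theorem memLp_comp_equiv (L : E ≃L[ℝ] F) {f : F → ℂ} (hf : MemLp f 2) :
    MemLp (fun x => f (L x)) 2 := by
  refine ⟨hf.1.comp_quasiMeasurePreserving (quasiMeasurePreserving_equiv L), ?_⟩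
  rw [eLpNorm_comp_equiv]
  exact ENNReal.mul_lt_top (ENNReal.rpow_lt_top_of_nonneg (by norm_num) ENNReal.coe_ne_top) hf.2

theorem tendsto_eLpNorm_comp_equiv (L : E ≃L[ℝ] F) {ι : Type*} {l : Filter ι} {f : ι → F → ℂ}
    (hf : Tendsto (fun i => eLpNorm (f i) 2 volume) l (𝓝 0)) :
    Tendsto (fun i => eLpNorm (fun x => f i (L x)) 2 volume) l (𝓝 0) := by
  simp only [eLpNorm_comp_equiv]
  have := ENNReal.Tendsto.const_mul (a := (volumeFactor L : ℝ≥0∞) ^ (1 / 2 : ℝ)) hf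
    (Or.inr (ENNReal.rpow_ne_top_of_nonneg (by norm_num) ENNReal.coe_ne_top))
  simpa using this

theorem ae_eq_comp_equiv (L : E ≃L[ℝ] F) {f g : F → ℂ} (h : f =ᵐ[volume] g) :
    (fun x => f (L x)) =ᵐ[volume] fun x => g (L x) :=
  (quasiMeasurePreserving_equiv L).ae_eq_comp h

end LinearEquiv

/-! ### The trace functional of a Hilbert–Schmidt operator -/

section

variable {I : Type*} [Fintype I] [DecidableEq I]

/-- The matrix element `⟨k| A |l⟩`, `p = (k, l)`. -/
def entry (A : Fock I →L[ℂ] Fock I) (p : (I → ℕ) × (I → ℕ)) : ℂ := A (numberState p.2) p.1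

theorem IsHilbertSchmidt.summable_entry {A : Fock I →L[ℂ] Fock I} (hA : IsHilbertSchmidt A) :
    Summable fun p => ‖entry A p‖ ^ 2 := by
  have h : ∀ l, HasSum (fun k => ‖A (numberState l) k‖ ^ 2) (‖A (numberState l)‖ ^ 2) := by
    intro l
    have := lp.hasSum_norm (p := 2) (by norm_num) (A (numberState l))
    simpa using this
  rw [← (Equiv.prodComm (I → ℕ) (I → ℕ)).summable_iff]
  change Summable fun p : (I → ℕ) × (I → ℕ) => ‖entry A p.swap‖ ^ 2
  rw [summable_prod_of_nonneg fun p => sq_nonneg ‖entry A p.swap‖]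
  refine ⟨fun l => (h l).summable, ?_⟩
  refine Summable.congr hA fun l => ?_
  exact (h l).tsum_eq.symm

theorem IsHilbertSchmidt.summable_trace {A : Fock I →L[ℂ] Fock I} (hA : IsHilbertSchmidt A) :
    Summable fun p => entry A p • dispL2 p.swap :=
  (summable_smul_dispL2 hA.summable_entry.prod_symm).prod_symm

/-- The functional `λ ↦ Tr {A D(λ)} = ∑ₖₗ ⟨k|A|l⟩ ⟨l|D(λ)|k⟩` as an element of `L²`. -/
def traceL2 (A : Fock I →L[ℂ] Fock I) : Lp (α := EuclideanSpace ℂ I) ℂ 2 :=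
  ∑' p, entry A p • dispL2 p.swap

omit [DecidableEq I] in
theorem coeFn_sum_dispL2 {ι : Type*} (a : ι → ℂ) (q : ι → (I → ℕ) × (I → ℕ)) (s : Finset ι) :
    ((∑ i ∈ s, a i • dispL2 (q i) : Lp (α := EuclideanSpace ℂ I) ℂ 2) : EuclideanSpace ℂ I → ℂ)
      =ᵐ[volume] fun v => ∑ i ∈ s, a i * dispSchwartz (q i).1 (q i).2 v := by
  have e : (∑ i ∈ s, a i • dispL2 (q i) : Lp (α := EuclideanSpace ℂ I) ℂ 2)
      = (∑ i ∈ s, a i • dispSchwartz (q i).1 (q i).2 : 𝓢(EuclideanSpace ℂ I, ℂ)).toLp 2 := by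
    have h := map_sum (SchwartzMap.toLpCLM ℂ (E := EuclideanSpace ℂ I) ℂ 2 volume)
      (fun i => a i • dispSchwartz (q i).1 (q i).2) s
    simp only [map_smul] at h
    exact h.symm
  rw [e]
  filter_upwards [SchwartzMap.coeFn_toLp
    (∑ i ∈ s, a i • dispSchwartz (q i).1 (q i).2 : 𝓢(EuclideanSpace ℂ I, ℂ)) 2 volume] with v hv
  rw [hv]
  simp [sum_apply]

omit [DecidableEq I] in
/-- A mean-square sum that also converges pointwise is equal to its pointwise sum. -/
theorem coeFn_eq_of_hasSum {ι : Type*} [Countable ι] {a : ι → ℂ} {q : ι → (I → ℕ) × (I → ℕ)}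
    {X : Lp (α := EuclideanSpace ℂ I) ℂ 2} {f : EuclideanSpace ℂ I → ℂ}
    (hX : HasSum (fun i => a i • dispL2 (q i)) X)
    (hf : ∀ v, HasSum (fun i => a i * dispSchwartz (q i).1 (q i).2 v) (f v)) :
    (X : EuclideanSpace ℂ I → ℂ) =ᵐ[volume] f := by
  obtain ⟨ns, hns, hlim⟩ := (tendstoInMeasure_of_tendsto_Lp hX).exists_seq_tendsto_ae'
  have h2 := ae_all_iff.2 fun n => coeFn_sum_dispL2 a q (ns n)
  filter_upwards [hlim, h2] with v hv hv2
  simp only [hv2] at hv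
  exact tendsto_nhds_unique hv ((hf v).comp hns)

end

namespace ModeSystem

variable {C D : ℕ} {B : Fin C → Type*} (S : ModeSystem C D B)

/-- The amplitudes as a vector of the Euclidean space over the set of all modes. -/
def coordEquiv : S.Amplitudes ≃L[ℝ] EuclideanSpace ℂ S.Mode :=
  LinearEquiv.toContinuousLinearEquiv
    { toFun := fun α => WithLp.toLp 2 fun m : S.Mode => α m.1 m.2
      invFun := fun v j n => v ⟨j, n⟩
      map_add' := fun _ _ => rfl
      map_smul' := fun _ _ => rfl
      left_inv := fun _ => rfl
      right_inv := fun _ => rfl }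

theorem coordEquiv_apply (α : S.Amplitudes) (m : S.Mode) : S.coordEquiv α m = α m.1 m.2 := rfl

theorem displacement_compose_apply (α : S.Amplitudes) (l k : S.Mode → ℕ) :
    S.displacement (S.compose α) (numberState l) k = dispSchwartz k l (S.coordEquiv α) := by
  rw [displacement_compose_numberState, dispSchwartz_apply]
  rfl

theorem hasSum_trace (A : Fock S.Mode →L[ℂ] Fock S.Mode) (k : S.Mode → ℕ) (α : S.Amplitudes) :
    HasSum (fun q => entry A (k, q) * dispSchwartz q k (S.coordEquiv α))
      (inner ℂ (numberState k) (A (S.displacement (S.compose α) (numberState k)))) := by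
  rw [inner_numberState]
  have h := hasSum_apply A (S.displacement (S.compose α) (numberState k)) k
  simp only [displacement_compose_apply, mul_comm] at h
  exact h

/-- The partial traces converge in mean square to `traceL2 A`. -/
theorem tendsto_trace {A : Fock S.Mode →L[ℂ] Fock S.Mode} (hA : IsHilbertSchmidt A) :
    (∀ s : Finset (S.Mode → ℕ), AEStronglyMeasurable (fun α => ∑ k ∈ s,
      inner ℂ (numberState k) (A (S.displacement (S.compose α) (numberState k)))) volume) ∧
    Tendsto (fun s : Finset (S.Mode → ℕ) => eLpNorm (fun α => ∑ k ∈ s,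
      inner ℂ (numberState k) (A (S.displacement (S.compose α) (numberState k)))
        - traceL2 A (S.coordEquiv α)) 2 volume) atTop (𝓝 0) := by
  have hk : ∀ k, HasSum (fun q => entry A (k, q) • dispL2 (q, k))
      (∑' q, entry A (k, q) • dispL2 (q, k)) :=
    fun k => (hA.summable_trace.prod_factor k).hasSum
  set x : (S.Mode → ℕ) → Lp (α := EuclideanSpace ℂ S.Mode) ℂ 2 :=
    fun k => ∑' q, entry A (k, q) • dispL2 (q, k) with hx
  have hsum : HasSum x (traceL2 A) := hA.summable_trace.hasSum.prod_fiberwise hk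
  have hae : ∀ k, (fun α => x k (S.coordEquiv α)) =ᵐ[volume] fun α =>
      inner ℂ (numberState k) (A (S.displacement (S.compose α) (numberState k))) := by
    intro k
    have h := coeFn_eq_of_hasSum (hk k) (f := fun v => inner ℂ (numberState k)
      (A (S.displacement (S.compose (S.coordEquiv.symm v)) (numberState k)))) (fun v => by
        simpa using S.hasSum_trace A k (S.coordEquiv.symm v))
    simpa using ae_eq_comp_equiv S.coordEquiv h
  have hs : ∀ s : Finset (S.Mode → ℕ), (fun α => (∑ k ∈ s, x k : Lp ℂ 2 volume) (S.coordEquiv α))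
      =ᵐ[volume] fun α => ∑ k ∈ s,
        inner ℂ (numberState k) (A (S.displacement (S.compose α) (numberState k))) := by
    intro s
    have h1 := ae_eq_comp_equiv S.coordEquiv (Lp.coeFn_finsetSum s x)
    have h2 := (ae_ball_iff s.countable_toSet).2 fun k (_ : k ∈ s) => hae k
    filter_upwards [h1, h2] with α h1 h2
    rw [h1, Finset.sum_apply]
    exact Finset.sum_congr rfl fun k hk => h2 k hk
  refine ⟨fun s => ((memLp_comp_equiv S.coordEquiv (Lp.memLp _)).1).congr (hs s), ?_⟩
  have ht : Tendsto (fun s : Finset (S.Mode → ℕ) =>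
      eLpNorm (fun v => (∑ k ∈ s, x k : Lp ℂ 2 volume) v - traceL2 A v) 2 volume) atTop (𝓝 0) := by
    have h := (tendsto_iff_edist_tendsto_0.1 (show Tendsto _ _ _ from hsum))
    simp only [Lp.edist_def] at h
    exact h
  refine (tendsto_eLpNorm_comp_equiv S.coordEquiv ht).congr fun s => eLpNorm_congr_ae ?_
  filter_upwards [hs s] with α hα
  rw [hα]

theorem isTraceFunctional_iff {A : Fock S.Mode →L[ℂ] Fock S.Mode} (hA : IsHilbertSchmidt A)
    (χ : S.Fields → ℂ) : S.IsTraceFunctional A χ ↔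
      (fun α => χ (S.compose α)) =ᵐ[volume] fun α => traceL2 A (S.coordEquiv α) := by
  have hm := memLp_comp_equiv S.coordEquiv (Lp.memLp (traceL2 A))
  obtain ⟨h1, h2⟩ := S.tendsto_trace hA
  constructor
  · rintro ⟨hχ, hlim⟩
    exact ae_eq_of_tendsto_eLpNorm_sub h1 hχ.1 hm.1 hlim h2
  · intro h
    refine ⟨(memLp_congr_ae h).2 hm, h2.congr fun s => eLpNorm_congr_ae ?_⟩
    filter_upwards [h] with α hα
    rw [hα]

/-! ### The Wigner transform as a Fourier transform -/

/-- Multiplication by `i / π`, which turns the symplectic form of the displacement functional into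
the Euclidean inner product of the Fourier transform. -/
def symplecticScale : EuclideanSpace ℂ S.Mode ≃L[ℝ] EuclideanSpace ℂ S.Mode :=
  ContinuousLinearEquiv.smulLeft (Units.mk0 (Complex.I / Real.pi)
    (div_ne_zero Complex.I_ne_zero (by exact_mod_cast Real.pi_ne_zero)))

theorem symplecticScale_apply (v : EuclideanSpace ℂ S.Mode) (m : S.Mode) :
    S.symplecticScale v m = Complex.I / Real.pi * v m := rfl

theorem two_pi_mul_re_mul_I (a b : ℂ) :
    2 * Real.pi * (((Complex.I / Real.pi * b * conj a).re : ℝ) : ℂ) * Complex.I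
      = a * conj b - conj a * b := by
  have hpi : (Real.pi : ℂ) ≠ 0 := by exact_mod_cast Real.pi_ne_zero
  have e : Complex.I / Real.pi * b * conj a = (1 / Real.pi : ℝ) * (Complex.I * (conj a * b)) := by
    push_cast; ring
  rw [e, Complex.re_ofReal_mul, Complex.I_mul_re]
  have h2 : a * conj b - conj a * b = -(2 * (conj a * b).im * Complex.I) := by
    have := Complex.sub_conj (conj a * b)
    rw [map_mul, Complex.conj_conj] at this
    push_cast at this
    linear_combination -this
  rw [h2]
  push_cast
  field_simp

theorem inner_symplecticScale (v w : EuclideanSpace ℂ S.Mode) :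
    2 * Real.pi * ((inner ℝ v (S.symplecticScale w) : ℝ) : ℂ) * Complex.I
      = ∑ m, (v m * conj (w m) - conj (v m) * w m) := by
  rw [PiLp.inner_apply, Complex.ofReal_sum, Finset.mul_sum, Finset.sum_mul]
  refine Finset.sum_congr rfl fun m _ => ?_
  rw [Complex.inner, symplecticScale_apply]
  exact two_pi_mul_re_mul_I (v m) (w m)

theorem prod_displacementFunctional (l α : S.Amplitudes) :
    ∏ j, S.displacementFunctional (S.compose l j) (S.compose α j)
      = Real.fourierChar (-inner ℝ (S.coordEquiv l) (S.symplecticScale (S.coordEquiv α))) := by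
  simp only [displacementFunctional_compose]
  rw [← Complex.exp_sum, Real.fourierChar_apply]
  congr 1
  have h := S.inner_symplecticScale (S.coordEquiv l) (S.coordEquiv α)
  push_cast
  rw [mul_neg, neg_mul, h, ← Finset.sum_neg_distrib, Fintype.sum_sigma]
  refine Finset.sum_congr rfl fun j _ => Finset.sum_congr rfl fun n _ => ?_
  simp only [coordEquiv_apply]
  ring

/-- The coordinates `i α / π` of the Fourier dual variable. -/
def dualEquiv : S.Amplitudes ≃L[ℝ] EuclideanSpace ℂ S.Mode :=
  S.coordEquiv.trans S.symplecticScale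

/-- The constant in front of the Fourier transform in the Wigner transform. -/
def wignerConst : ℂ :=
  ((Real.pi : ℂ) ^ (2 * ∑ j, (S.modes j).card))⁻¹ * (volumeFactor S.coordEquiv : ℂ)

/-- The Wigner transform of a square-integrable functional `X` as a function of the amplitudes. -/
def wignerFun (X : Lp (α := EuclideanSpace ℂ S.Mode) ℂ 2) (α : S.Amplitudes) : ℂ :=
  S.wignerConst * (𝓕 X : Lp ℂ 2 (volume : Measure (EuclideanSpace ℂ S.Mode))) (S.dualEquiv α)

theorem memLp_wignerFun (X : Lp (α := EuclideanSpace ℂ S.Mode) ℂ 2) :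
    MemLp (S.wignerFun X) 2 volume :=
  (memLp_comp_equiv S.dualEquiv (Lp.memLp (𝓕 X : Lp ℂ 2 volume))).const_mul _

/-- The box of amplitudes of modulus at most `R`. -/
def box (R : ℝ) : Set (EuclideanSpace ℂ S.Mode) := {v | ∀ m, ‖v m‖ ≤ R}

theorem isClosed_box (R : ℝ) : IsClosed (S.box R) := by
  simp only [box, Set.ofPred_forall]
  exact isClosed_iInter fun m => isClosed_le
    ((EuclideanSpace.proj m : EuclideanSpace ℂ S.Mode →L[ℂ] ℂ).continuous.norm) continuous_const

theorem volume_box_ne_top (R : ℝ) : volume (S.box R) ≠ ⊤ := by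
  refine (Bornology.IsBounded.measure_lt_top ?_).ne
  rw [isBounded_iff_forall_norm_le]
  refine ⟨√(∑ _m : S.Mode, R ^ 2), fun v hv => ?_⟩
  rw [EuclideanSpace.norm_eq]
  exact Real.sqrt_le_sqrt (Finset.sum_le_sum fun m _ => pow_le_pow_left₀ (norm_nonneg _) (hv m) 2)

theorem eventually_mem_box (v : EuclideanSpace ℂ S.Mode) : ∀ᶠ R in atTop, v ∈ S.box R := by
  filter_upwards [eventually_ge_atTop ‖v‖] with R hR m
  exact (PiLp.norm_apply_le v m).trans hR

theorem funcIntegral_box (χ : S.Fields → ℂ) (R : ℝ) (α : S.Amplitudes) :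
    S.funcIntegral (Set.indicator {Λ | ∀ j n, ‖S.decompose Λ j n‖ ≤ R}
      fun Λ => (∏ j, S.displacementFunctional (Λ j) (S.compose α j)) * χ Λ)
      = volumeFactor S.coordEquiv * 𝓕 ((S.box R).indicator
        fun v => χ (S.compose (S.coordEquiv.symm v))) (S.dualEquiv α) := by
  rw [Real.fourier_eq, ← integral_comp_equiv, funcIntegral]
  refine integral_congr_ae (Eventually.of_forall fun l => ?_)
  have hbox : S.coordEquiv l ∈ S.box R
      ↔ S.compose l ∈ {Λ : S.Fields | ∀ j n, ‖S.decompose Λ j n‖ ≤ R} := by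
    rw [Set.mem_ofPred_eq, decompose_compose]
    exact ⟨fun h j n => h ⟨j, n⟩, fun h m => h m.1 m.2⟩
  have e : S.dualEquiv α = S.symplecticScale (S.coordEquiv α) := rfl
  simp only [e, Circle.smul_def, ← prod_displacementFunctional]
  by_cases h : S.coordEquiv l ∈ S.box R
  · rw [Set.indicator_of_mem h, Set.indicator_of_mem (hbox.1 h)]
    simp
  · rw [Set.indicator_of_notMem h, Set.indicator_of_notMem (fun h' => h (hbox.2 h')), smul_zero]

theorem tendsto_box {X : Lp (α := EuclideanSpace ℂ S.Mode) ℂ 2} {χ : S.Fields → ℂ}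
    (hχ : (fun α => χ (S.compose α)) =ᵐ[volume] fun α => X (S.coordEquiv α)) :
    (∀ R : ℝ, AEStronglyMeasurable (fun α => ((Real.pi : ℂ) ^ (2 * ∑ j, (S.modes j).card))⁻¹ *
        S.funcIntegral (Set.indicator {Λ | ∀ j n, ‖S.decompose Λ j n‖ ≤ R}
          fun Λ => (∏ j, S.displacementFunctional (Λ j) (S.compose α j)) * χ Λ)) volume) ∧
    Tendsto (fun R : ℝ => eLpNorm (fun α => ((Real.pi : ℂ) ^ (2 * ∑ j, (S.modes j).card))⁻¹ *
        S.funcIntegral (Set.indicator {Λ | ∀ j n, ‖S.decompose Λ j n‖ ≤ R}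
          fun Λ => (∏ j, S.displacementFunctional (Λ j) (S.compose α j)) * χ Λ)
        - S.wignerFun X α) 2 volume) atTop (𝓝 0) := by
  set f : EuclideanSpace ℂ S.Mode → ℂ := fun v => χ (S.compose (S.coordEquiv.symm v)) with hf
  have hfX : f =ᵐ[volume] X := by
    have := ae_eq_comp_equiv S.coordEquiv.symm
      (f := fun α => χ (S.compose α)) (g := fun α => X (S.coordEquiv α)) hχ
    simpa using this
  have hfm : MemLp f 2 := (memLp_congr_ae hfX).2 (Lp.memLp X)
  have hX : hfm.toLp = X := Lp.ext (hfm.coeFn_toLp.trans hfX)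
  have hm := fun R => (S.isClosed_box R).measurableSet
  simp only [funcIntegral_box, ← mul_assoc]
  constructor
  · intro R
    have hR1 : Integrable ((S.box R).indicator f) volume := by
      rw [integrable_indicator_iff (hm R)]
      have : IsFiniteMeasure (volume.restrict (S.box R)) := ⟨by
        rw [Measure.restrict_apply_univ]; exact (S.volume_box_ne_top R).lt_top⟩
      exact (hfm.restrict (S.box R)).integrable (by norm_num)
    exact (((continuous_fourier_of_integrable hR1).comp
      S.dualEquiv.continuous).const_mul _).aestronglyMeasurable
  · have h := tendsto_eLpNorm_comp_equiv S.dualEquiv (tendsto_eLpNorm_fourier_indicator_sub hfm hm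
      S.eventually_mem_box S.volume_box_ne_top)
    rw [hX] at h
    have h2 := ENNReal.Tendsto.const_mul (a := ‖S.wignerConst‖ₑ) h (Or.inr (by simp))
    rw [mul_zero] at h2
    refine h2.congr fun R => ?_
    rw [← eLpNorm_const_smul]
    congr 1
    ext α
    simp only [Pi.smul_apply, smul_eq_mul, wignerFun, wignerConst]
    ring

theorem isWignerTransform_iff {A : Fock S.Mode →L[ℂ] Fock S.Mode} (hA : IsHilbertSchmidt A)
    (W : S.Fields → ℂ) : S.IsWignerTransform A W ↔
      (fun α => W (S.compose α)) =ᵐ[volume] S.wignerFun (traceL2 A) := by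
  have hm := S.memLp_wignerFun (traceL2 A)
  constructor
  · rintro ⟨hW, χ, hχ, hlim⟩
    obtain ⟨h1, h2⟩ := S.tendsto_box ((S.isTraceFunctional_iff hA χ).1 hχ)
    exact ae_eq_of_tendsto_eLpNorm_sub h1 hW.1 hm.1 hlim h2
  · intro h
    have hχ : (fun α => traceL2 A (S.coordEquiv (S.decompose (S.compose α)))) =ᵐ[volume]
        fun α => traceL2 A (S.coordEquiv α) := by
      simp only [decompose_compose]; rfl
    obtain ⟨h1, h2⟩ := S.tendsto_box (χ := fun Λ => traceL2 A (S.coordEquiv (S.decompose Λ))) hχ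
    refine ⟨(memLp_congr_ae h).2 hm, fun Λ => traceL2 A (S.coordEquiv (S.decompose Λ)),
      (S.isTraceFunctional_iff hA _).2 hχ,
      h2.congr fun s => eLpNorm_congr_ae ?_⟩
    filter_upwards [h] with α hα
    rw [hα]

end ModeSystem

/-! ### Pairing the Wigner transform with test functionals -/

section

variable {E : Type*} [NormedAddCommGroup E] [InnerProductSpace ℝ E] [FiniteDimensional ℝ E]
  [MeasurableSpace E] [BorelSpace E]

theorem integrable_L2_mul_schwartz (X : Lp ℂ 2 (volume : Measure E)) (g : 𝓢(E, ℂ)) :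
    Integrable fun v => X v * g v :=
  (Lp.memLp X).integrable_mul (g.memLp 2)

theorem hasSum_integral_mul_schwartz {ι : Type*} {x : ι → Lp ℂ 2 (volume : Measure E)}
    {X : Lp ℂ 2 (volume : Measure E)} (hX : HasSum x X) (g : 𝓢(E, ℂ)) :
    HasSum (fun i => ∫ v, x i v * g v) (∫ v, X v * g v) := by
  have hg : MemLp (fun v => conj (g v)) 2 volume := (g.memLp 2 volume).star
  have e : ∀ Y : Lp ℂ 2 (volume : Measure E), innerSL ℂ hg.toLp Y = ∫ v, Y v * g v := by
    intro Y
    rw [innerSL_apply_apply, L2.inner_def]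
    refine integral_congr_ae ?_
    filter_upwards [hg.coeFn_toLp] with v hv
    rw [hv, RCLike.inner_apply, Complex.conj_conj]
  have h := hX.mapL (innerSL ℂ hg.toLp)
  simpa only [e] using h

end

section

variable {I : Type*} [Fintype I] [DecidableEq I]

/-- `∫ Tr {A D(λ)} g(λ) = ∑ₖₗ ⟨k|A|l⟩ ∫ ⟨l|D(λ)|k⟩ g(λ)`. -/
theorem IsHilbertSchmidt.hasSum_trace_mul {A : Fock I →L[ℂ] Fock I} (hA : IsHilbertSchmidt A)
    (g : 𝓢(EuclideanSpace ℂ I, ℂ)) :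
    HasSum (fun p => entry A p * pairing (dispSchwartz p.2 p.1) g) (∫ v, traceL2 A v * g v) := by
  have h := hasSum_integral_mul_schwartz hA.summable_trace.hasSum g
  refine h.congr_fun fun p => ?_
  rw [pairing, ← integral_const_mul]
  refine integral_congr_ae ?_
  filter_upwards [Lp.coeFn_smul (entry A p) (dispL2 p.swap),
    SchwartzMap.coeFn_toLp (dispSchwartz p.2 p.1) 2 volume] with v h1 h2
  rw [h1, Pi.smul_apply, smul_eq_mul, mul_assoc, ← h2]
  rfl

end

/-- Moving a weighted shift `σ` with left inverse `τ` from one factor of a sum to the other. -/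
theorem hasSum_shift {K : Type*} {σ τ : K → K} (hτ : ∀ p, τ (σ p) = p) {w : K → ℂ}
    (hw : ∀ p, p ∉ Set.range σ → w p = 0) (x y : K → ℂ) (t : ℂ) :
    HasSum (fun p => x p * (w p * y (τ p))) t ↔ HasSum (fun p => w (σ p) * x (σ p) * y p) t := by
  have hσ : Function.Injective σ := Function.LeftInverse.injective hτ
  rw [← hσ.hasSum_iff (f := fun p => x p * (w p * y (τ p))) fun p hp => by
    rw [hw p hp, zero_mul, mul_zero]]
  refine Eq.to_iff (congrArg (HasSum · t) (funext fun p => ?_))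
  simp only [Function.comp_apply, hτ]
  ring

section

variable {I : Type*} [Fintype I] [DecidableEq I]

omit [Fintype I] in
theorem hasSum_shift_fst (m : I) (x y : (I → ℕ) × (I → ℕ) → ℂ) (t : ℂ) :
    HasSum (fun p => x p * ((√(p.1 m : ℝ) : ℂ) * y (p.1 - Pi.single m 1, p.2))) t ↔
      HasSum (fun p => (√(p.1 m + 1 : ℝ) : ℂ) * x (p.1 + Pi.single m 1, p.2) * y p) t := by
  have h := hasSum_shift (K := (I → ℕ) × (I → ℕ)) (σ := fun p => (p.1 + Pi.single m 1, p.2))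
    (τ := fun p => (p.1 - Pi.single m 1, p.2)) (w := fun p => (√(p.1 m : ℝ) : ℂ))
    (fun p => by ext i <;> simp) (fun p hp => by
      by_contra h0
      refine hp ⟨(p.1 - Pi.single m 1, p.2), Prod.ext ?_ rfl⟩
      exact (shift_iff _ _ m).2 ⟨fun h => h0 (by simp [h]), rfl⟩) x y t
  simpa using h

omit [Fintype I] in
theorem hasSum_shift_snd (m : I) (x y : (I → ℕ) × (I → ℕ) → ℂ) (t : ℂ) :
    HasSum (fun p => x p * ((√(p.2 m : ℝ) : ℂ) * y (p.1, p.2 - Pi.single m 1))) t ↔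
      HasSum (fun p => (√(p.2 m + 1 : ℝ) : ℂ) * x (p.1, p.2 + Pi.single m 1) * y p) t := by
  have h := hasSum_shift (K := (I → ℕ) × (I → ℕ)) (σ := fun p => (p.1, p.2 + Pi.single m 1))
    (τ := fun p => (p.1, p.2 - Pi.single m 1)) (w := fun p => (√(p.2 m : ℝ) : ℂ))
    (fun p => by ext i <;> simp) (fun p hp => by
      by_contra h0
      refine hp ⟨(p.1, p.2 - Pi.single m 1), Prod.ext rfl ?_⟩
      exact (shift_iff _ _ m).2 ⟨fun h => h0 (by simp [h]), rfl⟩) x y t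
  simpa using h

theorem annihilate_numberState (m : I) (l : I → ℕ) :
    annihilate m ⇑(numberState l : Fock I)
      = (√(l m : ℝ) : ℂ) • ⇑(numberState (l - Pi.single m 1) : Fock I) := by
  ext k
  simp only [annihilate, LinearMap.coe_mk, AddHom.coe_mk, numberState_apply, Pi.smul_apply,
    smul_eq_mul, Pi.single_apply]
  by_cases h : k + Pi.single m 1 = l
  · have h2 := (shift_iff k l m).1 h
    rw [if_pos h, if_pos h2.2, ← h]
    simp
  · rw [if_neg h, mul_zero]
    by_cases h0 : l m = 0
    · simp [h0]
    · rw [if_neg fun h2 => h ((shift_iff k l m).2 ⟨h0, h2⟩), mul_zero]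

theorem create_numberState (m : I) (l : I → ℕ) :
    create m ⇑(numberState l : Fock I)
      = (√(l m + 1 : ℝ) : ℂ) • ⇑(numberState (l + Pi.single m 1) : Fock I) := by
  ext k
  simp only [create, LinearMap.coe_mk, AddHom.coe_mk, numberState_apply, Pi.smul_apply,
    smul_eq_mul, Pi.single_apply]
  by_cases h : l + Pi.single m 1 = k
  · have h2 := (shift_iff l k m).1 h
    rw [if_pos h2.2.symm, if_pos h.symm, ← h]
    simp
  · rw [if_neg (Ne.symm h), mul_zero]
    by_cases h0 : k m = 0
    · simp [h0]
    · rw [if_neg fun h2 => h ((shift_iff l k m).2 ⟨h0, h2.symm⟩), mul_zero]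

end

namespace ModeSystem

variable {C D : ℕ} {B : Fin C → Type*} (S : ModeSystem C D B)

/-- The symplectic Fourier transform `f ↦ ∫ exp (∑ₘ (-λₘ αₘ* + λₘ* αₘ)) f(α) d²α` of Schwartz
functions, up to a constant factor. -/
def symplecticFourier :
    𝓢(EuclideanSpace ℂ S.Mode, ℂ) →L[ℂ] 𝓢(EuclideanSpace ℂ S.Mode, ℂ) :=
  FourierTransform.fourierCLM ℂ 𝓢(EuclideanSpace ℂ S.Mode, ℂ) ∘L
    SchwartzMap.compCLMOfContinuousLinearEquiv ℂ S.symplecticScale.symm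

theorem symplecticFourier_apply (f : 𝓢(EuclideanSpace ℂ S.Mode, ℂ)) :
    S.symplecticFourier f
      = 𝓕 (SchwartzMap.compCLMOfContinuousLinearEquiv ℂ S.symplecticScale.symm f) := rfl

theorem inner_symplecticScale_single (v : EuclideanSpace ℂ S.Mode) (m : S.Mode) (ζ : ℂ) :
    2 * Real.pi * ((inner ℝ v (S.symplecticScale (EuclideanSpace.single m ζ)) : ℝ) : ℂ) * Complex.I
      = conj ζ * v m - ζ * conj (v m) := by
  rw [inner_symplecticScale, Finset.sum_eq_single m]
  · simp only [PiLp.single_apply, if_true]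
    ring
  · intro i _ hi
    simp [hi]
  · simp

theorem inner_single_symplecticScale (v : EuclideanSpace ℂ S.Mode) (m : S.Mode) (ζ : ℂ) :
    2 * Real.pi * ((inner ℝ (EuclideanSpace.single m ζ) (S.symplecticScale v) : ℝ) : ℂ) * Complex.I
      = ζ * conj (v m) - conj ζ * v m := by
  rw [inner_symplecticScale, Finset.sum_eq_single m]
  · simp
  · intro i _ hi
    simp [hi]
  · simp

theorem lineDeriv_symplecticFourier (f : 𝓢(EuclideanSpace ℂ S.Mode, ℂ)) (m : S.Mode) (ζ : ℂ) :
    ∂_{EuclideanSpace.single m ζ} (S.symplecticFourier f)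
      = S.symplecticFourier (conj ζ • mulCoord m f - ζ • mulConjCoord m f) := by
  rw [symplecticFourier_apply, SchwartzMap.lineDerivOp_fourier_eq, symplecticFourier_apply]
  congr 1
  ext ξ
  have h := S.inner_single_symplecticScale (S.symplecticScale.symm ξ) m ζ
  rw [ContinuousLinearEquiv.apply_symm_apply, real_inner_comm] at h
  simp only [smul_apply, SchwartzMap.compCLMOfContinuousLinearEquiv_apply, Function.comp_apply,
    sub_apply, mulCoord_apply, mulConjCoord_apply, smul_eq_mul]
  rw [SchwartzMap.smulLeftCLM_apply_apply (by fun_prop)]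
  simp only [SchwartzMap.compCLMOfContinuousLinearEquiv_apply, Function.comp_apply,
    Complex.real_smul]
  linear_combination -f (S.symplecticScale.symm ξ) * h

theorem symplecticFourier_lineDeriv (f : 𝓢(EuclideanSpace ℂ S.Mode, ℂ)) (m : S.Mode) (ζ : ℂ) :
    S.symplecticFourier (∂_{EuclideanSpace.single m ζ} f)
      = conj ζ • mulCoord m (S.symplecticFourier f)
        - ζ • mulConjCoord m (S.symplecticFourier f) := by
  have h0 := SchwartzMap.lineDerivOp_compCLMOfContinuousLinearEquiv ℂ
    (S.symplecticScale (EuclideanSpace.single m ζ)) S.symplecticScale.symm f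
  rw [ContinuousLinearEquiv.symm_apply_apply] at h0
  rw [symplecticFourier_apply, ← h0, SchwartzMap.fourier_lineDerivOp_eq, ← symplecticFourier_apply]
  ext v
  have h := S.inner_symplecticScale_single v m ζ
  simp only [smul_apply, sub_apply, mulCoord_apply, mulConjCoord_apply, smul_eq_mul]
  rw [SchwartzMap.smulLeftCLM_apply_apply (by fun_prop), Complex.real_smul]
  linear_combination S.symplecticFourier f v * h

theorem symplecticFourier_mulCoord (f : 𝓢(EuclideanSpace ℂ S.Mode, ℂ)) (m : S.Mode) :
    S.symplecticFourier (mulCoord m f) = wirtConj m (S.symplecticFourier f) := by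
  rw [wirtConj, lineDeriv_symplecticFourier, lineDeriv_symplecticFourier]
  simp only [map_sub, map_smul, map_one, Complex.conj_I]
  ext v
  simp only [smul_apply, sub_apply, add_apply, smul_eq_mul]
  linear_combination (1 / 2 : ℂ) * (S.symplecticFourier (mulCoord m f) v
    + S.symplecticFourier (mulConjCoord m f) v) * Complex.I_sq

theorem symplecticFourier_mulConjCoord (f : 𝓢(EuclideanSpace ℂ S.Mode, ℂ)) (m : S.Mode) :
    S.symplecticFourier (mulConjCoord m f) = -wirt m (S.symplecticFourier f) := by
  rw [wirt, lineDeriv_symplecticFourier, lineDeriv_symplecticFourier]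
  simp only [map_sub, map_smul, map_one, Complex.conj_I]
  ext v
  simp only [smul_apply, sub_apply, neg_apply, smul_eq_mul]
  linear_combination (1 / 2 : ℂ) * (S.symplecticFourier (mulCoord m f) v
    + S.symplecticFourier (mulConjCoord m f) v) * Complex.I_sq

theorem symplecticFourier_wirtConj (f : 𝓢(EuclideanSpace ℂ S.Mode, ℂ)) (m : S.Mode) :
    S.symplecticFourier (wirtConj m f) = mulCoord m (S.symplecticFourier f) := by
  rw [wirtConj, map_smul, map_add, map_smul, symplecticFourier_lineDeriv,
    symplecticFourier_lineDeriv]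
  ext v
  simp only [smul_apply, sub_apply, add_apply, smul_eq_mul, map_one, Complex.conj_I]
  linear_combination (-1 / 2 : ℂ) * (mulCoord m (S.symplecticFourier f) v
    + mulConjCoord m (S.symplecticFourier f) v) * Complex.I_sq

theorem symplecticFourier_wirt (f : 𝓢(EuclideanSpace ℂ S.Mode, ℂ)) (m : S.Mode) :
    S.symplecticFourier (wirt m f) = -mulConjCoord m (S.symplecticFourier f) := by
  rw [wirt, map_smul, map_sub, map_smul, symplecticFourier_lineDeriv,
    symplecticFourier_lineDeriv]
  ext v
  simp only [smul_apply, sub_apply, neg_apply, smul_eq_mul, map_one, Complex.conj_I]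
  linear_combination (1 / 2 : ℂ) * (mulCoord m (S.symplecticFourier f) v
    + mulConjCoord m (S.symplecticFourier f) v) * Complex.I_sq

theorem integral_wignerFun_mul (X : Lp ℂ 2 (volume : Measure (EuclideanSpace ℂ S.Mode)))
    (f : 𝓢(EuclideanSpace ℂ S.Mode, ℂ)) :
    ∫ α, S.wignerFun X α * f (S.coordEquiv α)
      = S.wignerConst * volumeFactor S.dualEquiv * ∫ v, X v * S.symplecticFourier f v := by
  rw [symplecticFourier_apply, ← integral_fourier_L2_mul, mul_assoc, ← integral_comp_equiv,
    ← integral_const_mul]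
  refine integral_congr_ae (Eventually.of_forall fun α => ?_)
  have e : S.symplecticScale.symm (S.dualEquiv α) = S.coordEquiv α :=
    S.symplecticScale.symm_apply_apply _
  simp only [wignerFun, SchwartzMap.compCLMOfContinuousLinearEquiv_apply, Function.comp_apply, e]
  ring

/-- If the matrix elements of `P` arise from those of `A` by operations that are transposed to the
operations `g ↦ g' n` on the symplectic Fourier side, then so do the pairings of the Wigner
transforms. -/
theorem integral_wignerFun_of_hasSum {A P : Fock S.Mode →L[ℂ] Fock S.Mode}
    (hP : IsHilbertSchmidt P) {ι : Type*} [Fintype ι] (c : ι → ℂ)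
    (a : ι → (S.Mode → ℕ) × (S.Mode → ℕ) → ℂ) (hPa : ∀ p, entry P p = ∑ n, c n * a n p)
    (f : 𝓢(EuclideanSpace ℂ S.Mode, ℂ)) (f' : ι → 𝓢(EuclideanSpace ℂ S.Mode, ℂ))
    (h : ∀ n, HasSum (fun p => a n p * pairing (dispSchwartz p.2 p.1) (S.symplecticFourier f))
      (∫ v, traceL2 A v * S.symplecticFourier (f' n) v)) :
    ∫ α, S.wignerFun (traceL2 P) α * f (S.coordEquiv α)
      = ∫ α, S.wignerFun (traceL2 A) α * (∑ n, c n • f' n) (S.coordEquiv α) := by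
  rw [integral_wignerFun_mul, integral_wignerFun_mul]
  congr 1
  have h1 := hasSum_sum (s := Finset.univ) fun n _ => (h n).mul_left (c n)
  have h2 := hP.hasSum_trace_mul (S.symplecticFourier f)
  have e : (fun p => entry P p * pairing (dispSchwartz p.2 p.1) (S.symplecticFourier f))
      = fun p => ∑ n, c n * (a n p * pairing (dispSchwartz p.2 p.1) (S.symplecticFourier f)) := by
    ext p
    rw [hPa, Finset.sum_mul]
    exact Finset.sum_congr rfl fun n _ => mul_assoc _ _ _
  rw [e] at h2
  rw [h2.unique h1]
  simp only [← integral_const_mul]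
  rw [← integral_finsetSum _ fun n _ => (integrable_L2_mul_schwartz _ _).const_mul (c n)]
  refine integral_congr_ae (Eventually.of_forall fun v => ?_)
  simp only [map_sum, map_smul, sum_apply, smul_apply, smul_eq_mul, Finset.mul_sum]
  exact Finset.sum_congr rfl fun n _ => by ring

section Products

variable {A P : Fock S.Mode →L[ℂ] Fock S.Mode} (hA : IsHilbertSchmidt A) (hP : IsHilbertSchmidt P)
  (j : Fin C) (x : EuclideanSpace ℝ (Fin D)) (f : 𝓢(EuclideanSpace ℂ S.Mode, ℂ))

include hA hP

/-! In the following four lemmas the weighted shift of `entry A` that the field operator produces is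
moved to the matrix elements of the displacement operator by `hasSum_shift_fst` (a shift of the left
index, for products `Ψ̃ A`) or `hasSum_shift_snd` (of the right index, for products `A Ψ̃`), from
there to the symplectic Fourier transform of `f` by a `pairing` identity, and then to `f`. -/

theorem integral_wignerFun_fieldOp_left (h : IsLeftProduct (S.fieldOp j x) A P) :
    ∫ α, S.wignerFun (traceL2 P) α * f (S.coordEquiv α)
      = ∫ α, S.wignerFun (traceL2 A) α * (∑ n : S.modes j, S.φ j n x •
        (mulCoord (⟨j, n⟩ : S.Mode) f - (1 / 2 : ℂ) • wirtConj ⟨j, n⟩ f)) (S.coordEquiv α) := by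
  refine S.integral_wignerFun_of_hasSum hP _ (fun n p => (√(p.1 ⟨j, n⟩ + 1 : ℝ) : ℂ) *
    entry A (p.1 + Pi.single ⟨j, n⟩ 1, p.2)) (fun p => ?_) f _ fun n => ?_
  · rw [entry, h]
    simp [fieldOp, LinearMap.sum_apply, Finset.sum_apply, annihilate, entry]
  · refine (hasSum_shift_fst _ (entry A) (fun p => pairing (dispSchwartz p.2 p.1)
      (S.symplecticFourier f)) _).1 ?_
    simp only [pairing_sub_single_right]
    rw [map_sub, map_smul, symplecticFourier_mulCoord, symplecticFourier_wirtConj]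
    exact hA.hasSum_trace_mul _

theorem integral_wignerFun_fieldOpDag_left (h : IsLeftProduct (S.fieldOpDag j x) A P) :
    ∫ α, S.wignerFun (traceL2 P) α * f (S.coordEquiv α)
      = ∫ α, S.wignerFun (traceL2 A) α * (∑ n : S.modes j, conj (S.φ j n x) •
        (mulConjCoord (⟨j, n⟩ : S.Mode) f - (-1 / 2 : ℂ) • wirt ⟨j, n⟩ f)) (S.coordEquiv α) := by
  refine S.integral_wignerFun_of_hasSum hP _ (fun n p => (√(p.1 ⟨j, n⟩ : ℝ) : ℂ) *
    entry A (p.1 - Pi.single ⟨j, n⟩ 1, p.2)) (fun p => ?_) f _ fun n => ?_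
  · rw [entry, h]
    simp [fieldOpDag, LinearMap.sum_apply, Finset.sum_apply, create, entry]
  · have h1 := (hasSum_shift_fst ⟨j, n⟩ (fun p => pairing (dispSchwartz p.2 p.1)
      (S.symplecticFourier f)) (entry A) (∫ v, traceL2 A v * S.symplecticFourier
        (mulConjCoord (⟨j, n⟩ : S.Mode) f - (-1 / 2 : ℂ) • wirt ⟨j, n⟩ f) v)).2 ?_
    · simpa only [mul_comm] using h1
    simp only [pairing_add_single_right]
    rw [map_sub, map_smul, symplecticFourier_mulConjCoord, symplecticFourier_wirt]
    have h2 := hA.hasSum_trace_mul (-wirt ⟨j, n⟩ (S.symplecticFourier f)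
      - (1 / 2 : ℂ) • mulConjCoord ⟨j, n⟩ (S.symplecticFourier f))
    have e : (-1 / 2 : ℂ) • -mulConjCoord ⟨j, n⟩ (S.symplecticFourier f)
      = (1 / 2 : ℂ) • mulConjCoord ⟨j, n⟩ (S.symplecticFourier f) := by
      rw [smul_neg, ← neg_smul]; norm_num
    rw [e]
    simpa only [mul_comm] using h2

theorem integral_wignerFun_fieldOp_right (h : IsRightProduct (S.fieldOp j x) A P) :
    ∫ α, S.wignerFun (traceL2 P) α * f (S.coordEquiv α)
      = ∫ α, S.wignerFun (traceL2 A) α * (∑ n : S.modes j, S.φ j n x •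
        (mulCoord (⟨j, n⟩ : S.Mode) f - (-1 / 2 : ℂ) • wirtConj ⟨j, n⟩ f)) (S.coordEquiv α) := by
  refine S.integral_wignerFun_of_hasSum hP _ (fun n p => (√(p.2 ⟨j, n⟩ : ℝ) : ℂ) *
    entry A (p.1, p.2 - Pi.single ⟨j, n⟩ 1)) (fun p => ?_) f _ fun n => ?_
  · rw [entry, h _ (∑ n : S.modes j, (S.φ j n x * (√(p.2 ⟨j, n⟩ : ℝ) : ℂ)) •
      numberState (p.2 - Pi.single ⟨j, n⟩ 1))]
    · rw [map_sum, lp.coeFn_sum, Finset.sum_apply]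
      simp [entry, mul_assoc]
    · simp only [fieldOp, LinearMap.sum_apply, LinearMap.smul_apply, annihilate_numberState,
        lp.coeFn_sum, lp.coeFn_smul, smul_smul]
  · have h1 := (hasSum_shift_snd ⟨j, n⟩ (fun p => pairing (dispSchwartz p.2 p.1)
      (S.symplecticFourier f)) (entry A) (∫ v, traceL2 A v * S.symplecticFourier
        (mulCoord (⟨j, n⟩ : S.Mode) f - (-1 / 2 : ℂ) • wirtConj ⟨j, n⟩ f) v)).2 ?_
    · simpa only [mul_comm] using h1
    simp only [pairing_add_single_left]
    rw [map_sub, map_smul, symplecticFourier_mulCoord, symplecticFourier_wirtConj]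
    have h2 := hA.hasSum_trace_mul (wirtConj ⟨j, n⟩ (S.symplecticFourier f)
      + (1 / 2 : ℂ) • mulCoord ⟨j, n⟩ (S.symplecticFourier f))
    rw [neg_div, neg_smul, sub_neg_eq_add]
    simpa only [mul_comm] using h2

theorem integral_wignerFun_fieldOpDag_right (h : IsRightProduct (S.fieldOpDag j x) A P) :
    ∫ α, S.wignerFun (traceL2 P) α * f (S.coordEquiv α)
      = ∫ α, S.wignerFun (traceL2 A) α * (∑ n : S.modes j, conj (S.φ j n x) •
        (mulConjCoord (⟨j, n⟩ : S.Mode) f - (1 / 2 : ℂ) • wirt ⟨j, n⟩ f)) (S.coordEquiv α) := by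
  refine S.integral_wignerFun_of_hasSum hP _ (fun n p => (√(p.2 ⟨j, n⟩ + 1 : ℝ) : ℂ) *
    entry A (p.1, p.2 + Pi.single ⟨j, n⟩ 1)) (fun p => ?_) f _ fun n => ?_
  · rw [entry, h _ (∑ n : S.modes j, (conj (S.φ j n x) * (√(p.2 ⟨j, n⟩ + 1 : ℝ) : ℂ)) •
      numberState (p.2 + Pi.single ⟨j, n⟩ 1))]
    · rw [map_sum, lp.coeFn_sum, Finset.sum_apply]
      simp [entry, mul_assoc]
    · simp only [fieldOpDag, LinearMap.sum_apply, LinearMap.smul_apply, create_numberState,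
        lp.coeFn_sum, lp.coeFn_smul, smul_smul]
  · refine (hasSum_shift_snd _ (entry A) (fun p => pairing (dispSchwartz p.2 p.1)
      (S.symplecticFourier f)) _).1 ?_
    simp only [pairing_sub_single_left]
    rw [map_sub, map_smul, symplecticFourier_mulConjCoord, symplecticFourier_wirt]
    have e : -wirt ⟨j, n⟩ (S.symplecticFourier f)
        - (1 / 2 : ℂ) • -mulConjCoord ⟨j, n⟩ (S.symplecticFourier f)
      = (1 / 2 : ℂ) • mulConjCoord ⟨j, n⟩ (S.symplecticFourier f)
        - wirt ⟨j, n⟩ (S.symplecticFourier f) := by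
      rw [smul_neg]; abel
    rw [e]
    exact hA.hasSum_trace_mul _

end Products

end ModeSystem

namespace ModeSystem

variable {C D : ℕ} {B : Fin C → Type*} (S : ModeSystem C D B)

/-! ### Weak functional derivatives of the Wigner transform -/

/-- A test functional as a Schwartz function of the vector of all amplitudes. -/
def testSchwartz {η : S.Fields → ℂ} (hη : S.IsTest η) : 𝓢(EuclideanSpace ℂ S.Mode, ℂ) :=
  (hη.2.comp_homeomorph S.coordEquiv.symm.toHomeomorph).toSchwartzMap
    (hη.1.comp S.coordEquiv.symm.contDiff)

theorem testSchwartz_coordEquiv {η : S.Fields → ℂ} (hη : S.IsTest η) (α : S.Amplitudes) :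
    S.testSchwartz hη (S.coordEquiv α) = η (S.compose α) := by
  change η (S.compose (S.coordEquiv.symm (S.coordEquiv α))) = _
  rw [ContinuousLinearEquiv.symm_apply_apply]

theorem coordEquiv_direction (j : Fin C) (n : S.modes j) (ζ : ℂ) :
    S.coordEquiv (S.direction j n ζ) = EuclideanSpace.single ⟨j, n⟩ ζ := by
  ext ⟨i, m⟩
  rw [coordEquiv_apply, PiLp.single_apply, direction]
  by_cases hi : i = j
  · subst hi
    by_cases hm : m = n
    · subst hm; simp
    · rw [if_neg (by simpa using hm)]
      simp [hm]
  · rw [if_neg (by rintro ⟨⟩; exact hi rfl)]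
    simp [hi]

theorem lineDeriv_testSchwartz {η : S.Fields → ℂ} (hη : S.IsTest η) (α : S.Amplitudes)
    (j : Fin C) (n : S.modes j) (ζ : ℂ) :
    lineDeriv ℝ (S.testSchwartz hη) (S.coordEquiv α) (EuclideanSpace.single ⟨j, n⟩ ζ)
      = lineDeriv ℝ (fun α => η (S.compose α)) α (S.direction j n ζ) := by
  simp only [lineDeriv, ← coordEquiv_direction, ← map_smul, ← map_add, testSchwartz_coordEquiv]

theorem funcDeriv_compose {η : S.Fields → ℂ} (hη : S.IsTest η) (j : Fin C)
    (x : EuclideanSpace ℝ (Fin D)) (α : S.Amplitudes) :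
    S.funcDeriv j x η (S.compose α) = ∑ n : S.modes j,
      conj (S.φ j n x) * wirt ⟨j, n⟩ (S.testSchwartz hη) (S.coordEquiv α) := by
  simp only [funcDeriv, wirtinger, wirt_apply, lineDeriv_testSchwartz, decompose_compose]

theorem funcDerivConj_compose {η : S.Fields → ℂ} (hη : S.IsTest η) (j : Fin C)
    (x : EuclideanSpace ℝ (Fin D)) (α : S.Amplitudes) :
    S.funcDerivConj j x η (S.compose α) = ∑ n : S.modes j,
      S.φ j n x * wirtConj ⟨j, n⟩ (S.testSchwartz hη) (S.coordEquiv α) := by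
  simp only [funcDerivConj, wirtingerConj, wirtConj_apply, lineDeriv_testSchwartz,
    decompose_compose]

theorem integrable_mul_schwartz {F : S.Amplitudes → ℂ} (hF : MemLp F 2 volume)
    (g : 𝓢(EuclideanSpace ℂ S.Mode, ℂ)) : Integrable fun α => F α * g (S.coordEquiv α) :=
  hF.integrable_mul (memLp_comp_equiv S.coordEquiv (g.memLp 2 volume))

/-- If `V = (u + c δ) F` holds against the test function `f`, with `δ = ∑ₙ aₙ ∂ₙ` and
`u f = ∑ₙ aₙ mₙ`, then `c⁻¹ (V - u F)` is `δ F` against `f`. -/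
theorem integral_mul_deriv_eq_neg {F V u : S.Amplitudes → ℂ} (hF : MemLp F 2 volume)
    (hV : MemLp V 2 volume) {ι : Type*} [Fintype ι] (a : ι → ℂ) {c : ℂ} (hc : c ≠ 0)
    (f : 𝓢(EuclideanSpace ℂ S.Mode, ℂ)) (m d : ι → 𝓢(EuclideanSpace ℂ S.Mode, ℂ))
    (hu : ∀ α, ∑ n, a n * m n (S.coordEquiv α) = u α * f (S.coordEquiv α))
    (h : ∫ α, V α * f (S.coordEquiv α)
      = ∫ α, F α * (∑ n, a n • (m n - c • d n)) (S.coordEquiv α)) :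
    ∫ α, F α * ∑ n, a n * d n (S.coordEquiv α)
      = -∫ α, c⁻¹ * (V α - u α * F α) * f (S.coordEquiv α) := by
  have hd : ∀ α, ∑ n, a n * d n (S.coordEquiv α) = (∑ n, a n • d n) (S.coordEquiv α) := by
    intro α
    simp [sum_apply]
  have hm : ∀ α, u α * f (S.coordEquiv α) = (∑ n, a n • m n) (S.coordEquiv α) := by
    intro α
    rw [← hu]
    simp [sum_apply]
  have e1 : ∑ n, a n • (m n - c • d n) = ∑ n, a n • m n - c • ∑ n, a n • d n := by
    simp only [smul_sub, Finset.sum_sub_distrib, Finset.smul_sum, smul_comm c]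
  have e2 : ∀ α, c⁻¹ * (V α - u α * F α) * f (S.coordEquiv α)
      = c⁻¹ * (V α * f (S.coordEquiv α) - F α * (∑ n, a n • m n) (S.coordEquiv α)) := by
    intro α
    rw [← hm]
    ring
  have e3 : ∀ α, F α * (∑ n, a n • m n - c • ∑ n, a n • d n) (S.coordEquiv α)
      = F α * (∑ n, a n • m n) (S.coordEquiv α)
        - c * (F α * (∑ n, a n • d n) (S.coordEquiv α)) := by
    intro α
    rw [sub_apply, smul_apply, smul_eq_mul]
    ring
  have iF := S.integrable_mul_schwartz hF
  rw [e1] at h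
  simp only [e3] at h
  rw [integral_sub (iF _) ((iF _).const_mul c), integral_const_mul] at h
  simp only [hd, e2]
  rw [integral_const_mul, integral_sub (S.integrable_mul_schwartz hV f) (iF _), h]
  field_simp
  ring

theorem continuous_compose_apply (j : Fin C) (x : EuclideanSpace ℝ (Fin D)) :
    Continuous fun α => (S.compose α j).1 x :=
  continuous_finsetSum _ fun n _ =>
    continuous_const.mul ((continuous_apply n).comp (continuous_apply j))

section

variable {A P : Fock S.Mode →L[ℂ] Fock S.Mode} (hA : IsHilbertSchmidt A) (hP : IsHilbertSchmidt P)
  {W : S.Fields → ℂ} (hW : S.IsWignerTransform A W) (j : Fin C) (x : EuclideanSpace ℝ (Fin D))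

include hP hW

/-- The candidate `G = c⁻¹ (𝒲[P] - u W)` for the weak derivative of `W` is locally integrable, and
`𝒲[P] = u W + c G` by construction. -/
theorem exists_weak_derivative {u : S.Fields → ℂ} (hu : Continuous fun α => u (S.compose α)) {c : ℂ}
    (hc : c ≠ 0) : ∃ G : S.Fields → ℂ, (∀ α, G (S.compose α)
      = c⁻¹ * (S.wignerFun (traceL2 P) α - u (S.compose α) * W (S.compose α))) ∧
      S.LocInt W ∧ S.LocInt G ∧ S.IsWignerTransform P fun Ψ => u Ψ * W Ψ + c * G Ψ := by
  have hl : S.LocInt W := hW.1.locallyIntegrable (by norm_num)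
  refine ⟨fun Ψ => c⁻¹ * (S.wignerFun (traceL2 P) (S.decompose Ψ) - u Ψ * W Ψ),
    fun α => by simp only [decompose_compose], hl, ?_, ?_⟩
  · have h1 : LocallyIntegrable (S.wignerFun (traceL2 P)) volume :=
      (S.memLp_wignerFun _).locallyIntegrable (by norm_num)
    have h2 := (h1.sub (LocallyIntegrable.continuous_mul hu hl)).smul c⁻¹
    simp only [LocInt, decompose_compose]
    exact h2
  · rw [S.isWignerTransform_iff hP]
    refine Eventually.of_forall fun α => ?_
    simp only [decompose_compose]
    field_simp
    ring

include hA

theorem exists_isWeakFuncDerivConj {c : ℂ} (hc : c ≠ 0)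
    (h : ∀ f, ∫ α, S.wignerFun (traceL2 P) α * f (S.coordEquiv α)
      = ∫ α, S.wignerFun (traceL2 A) α * (∑ n : S.modes j, S.φ j n x •
        (mulCoord (⟨j, n⟩ : S.Mode) f - c • wirtConj ⟨j, n⟩ f)) (S.coordEquiv α)) :
    ∃ G, S.IsWeakFuncDerivConj j x W G ∧
      S.IsWignerTransform P fun Ψ => (Ψ j).1 x * W Ψ + c * G Ψ := by
  obtain ⟨G, hG, h1, h2, h3⟩ := S.exists_weak_derivative hP hW (u := fun Ψ => (Ψ j).1 x)
    (S.continuous_compose_apply j x) hc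
  refine ⟨G, ⟨h1, h2, fun η hη => ?_⟩, h3⟩
  simp only [funcIntegral, S.funcDerivConj_compose hη, hG, ← S.testSchwartz_coordEquiv hη]
  refine S.integral_mul_deriv_eq_neg hW.1 (S.memLp_wignerFun _) _ hc (S.testSchwartz hη)
    (fun n => mulCoord ⟨j, n⟩ (S.testSchwartz hη)) _ (fun α => ?_) ?_
  · simp only [mulCoord_apply, coordEquiv_apply, compose, Finset.sum_mul, mul_assoc]
  · rw [h]
    refine integral_congr_ae ?_
    filter_upwards [(S.isWignerTransform_iff hA W).1 hW] with α hα
    rw [hα]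

theorem exists_isWeakFuncDeriv {c : ℂ} (hc : c ≠ 0)
    (h : ∀ f, ∫ α, S.wignerFun (traceL2 P) α * f (S.coordEquiv α)
      = ∫ α, S.wignerFun (traceL2 A) α * (∑ n : S.modes j, conj (S.φ j n x) •
        (mulConjCoord (⟨j, n⟩ : S.Mode) f - c • wirt ⟨j, n⟩ f)) (S.coordEquiv α)) :
    ∃ G, S.IsWeakFuncDeriv j x W G ∧
      S.IsWignerTransform P fun Ψ => conj ((Ψ j).1 x) * W Ψ + c * G Ψ := by
  obtain ⟨G, hG, h1, h2, h3⟩ := S.exists_weak_derivative hP hW (u := fun Ψ => conj ((Ψ j).1 x))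
    (Complex.continuous_conj.comp (S.continuous_compose_apply j x)) hc
  refine ⟨G, ⟨h1, h2, fun η hη => ?_⟩, h3⟩
  simp only [funcIntegral, S.funcDeriv_compose hη, hG, ← S.testSchwartz_coordEquiv hη]
  refine S.integral_mul_deriv_eq_neg hW.1 (S.memLp_wignerFun _) _ hc (S.testSchwartz hη)
    (fun n => mulConjCoord ⟨j, n⟩ (S.testSchwartz hη)) _ (fun α => ?_) ?_
  · simp only [mulConjCoord_apply, coordEquiv_apply, compose, map_sum, map_mul, Finset.sum_mul,
      mul_assoc]
  · rw [h]
    refine integral_congr_ae ?_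
    filter_upwards [(S.isWignerTransform_iff hA W).1 hW] with α hα
    rw [hα]

end

end ModeSystem

end

end FuncWigner

theorem mainTheorem1 {C D : ℕ} {B : Fin C → Type*} (S : FuncWigner.ModeSystem C D B)
    (A : FuncWigner.Fock S.Mode →L[ℂ] FuncWigner.Fock S.Mode)
    (hA : FuncWigner.IsHilbertSchmidt A) :
    -- `𝒲[A]` exists and is unique up to null sets
    (∃ W, S.IsWignerTransform A W) ∧
    (∀ W W', S.IsWignerTransform A W → S.IsWignerTransform A W' →
      (fun α => W (S.compose α)) =ᵐ[MeasureTheory.volume] fun α => W' (S.compose α)) ∧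
    ∀ W, S.IsWignerTransform A W →
      ∀ (j : Fin C) (x : EuclideanSpace ℝ (Fin D))
        (P : FuncWigner.Fock S.Mode →L[ℂ] FuncWigner.Fock S.Mode),
        FuncWigner.IsHilbertSchmidt P →
        -- `𝒲[Ψ̃_j A] = (Ψ_j + ½ δ/δΨ_j*) 𝒲[A]`
        (FuncWigner.IsLeftProduct (S.fieldOp j x) A P →
          ∃ G, S.IsWeakFuncDerivConj j x W G ∧
            S.IsWignerTransform P fun Ψ => (Ψ j).1 x * W Ψ + 1 / 2 * G Ψ) ∧
        -- `𝒲[Ψ̃_j† A] = (Ψ_j* - ½ δ/δΨ_j) 𝒲[A]`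
        (FuncWigner.IsLeftProduct (S.fieldOpDag j x) A P →
          ∃ G, S.IsWeakFuncDeriv j x W G ∧
            S.IsWignerTransform P fun Ψ => starRingEnd ℂ ((Ψ j).1 x) * W Ψ - 1 / 2 * G Ψ) ∧
        -- `𝒲[A Ψ̃_j] = (Ψ_j - ½ δ/δΨ_j*) 𝒲[A]`
        (FuncWigner.IsRightProduct (S.fieldOp j x) A P →
          ∃ G, S.IsWeakFuncDerivConj j x W G ∧
            S.IsWignerTransform P fun Ψ => (Ψ j).1 x * W Ψ - 1 / 2 * G Ψ) ∧
        -- `𝒲[A Ψ̃_j†] = (Ψ_j* + ½ δ/δΨ_j) 𝒲[A]`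
        (FuncWigner.IsRightProduct (S.fieldOpDag j x) A P →
          ∃ G, S.IsWeakFuncDeriv j x W G ∧
            S.IsWignerTransform P fun Ψ => starRingEnd ℂ ((Ψ j).1 x) * W Ψ + 1 / 2 * G Ψ) := by
  refine ⟨⟨fun Ψ => S.wignerFun (FuncWigner.traceL2 A) (S.decompose Ψ), ?_⟩,
    fun W W' hW hW' => ((S.isWignerTransform_iff hA W).1 hW).trans
      ((S.isWignerTransform_iff hA W').1 hW').symm,
    fun W hW j x P hP => ⟨fun h => ?_, fun h => ?_, fun h => ?_, fun h => ?_⟩⟩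
  · rw [S.isWignerTransform_iff hA]
    simp only [FuncWigner.ModeSystem.decompose_compose]
    rfl
  · exact S.exists_isWeakFuncDerivConj hA hP hW j x (by norm_num)
      fun f => S.integral_wignerFun_fieldOp_left hA hP j x f h
  · simpa only [neg_div, neg_mul, ← sub_eq_add_neg] using
      S.exists_isWeakFuncDeriv hA hP hW j x (c := -1 / 2) (by norm_num)
        fun f => S.integral_wignerFun_fieldOpDag_left hA hP j x f h
  · simpa only [neg_div, neg_mul, ← sub_eq_add_neg] using
      S.exists_isWeakFuncDerivConj hA hP hW j x (c := -1 / 2) (by norm_num)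
        fun f => S.integral_wignerFun_fieldOp_right hA hP j x f h
  · exact S.exists_isWeakFuncDeriv hA hP hW j x (by norm_num)
      fun f => S.integral_wignerFun_fieldOpDag_right hA hP j x f h
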